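/- Let $k$ be any field, let $0<p<q$ be coprime integers, let $\mathrm{rk}\ge 1$, and let $\mathcal R=k[[z^p,z^q]]\subset\mathcal O=k[[z]]$. Identify $\mathcal O^{\mathrm{rk}}$ with $\tilde{\mathcal O}=k[[z]][z^{1/\mathrm{rk}}]$, let $\upsilon$ be the valuation of $\tilde{\mathcal O}$ with $\upsilon(z^{j/\mathrm{rk}})=j$, and let $\tilde\Gamma=\upsilon(\mathcal R\setminus\{0\})=\mathrm{rk}\cdot(\mathbb Z_{\ge 0}\,p+\mathbb Z_{\ge 0}\,q)$. A standard rank-$\mathrm{rk}$ $\tilde\Gamma$-module is a set $\Delta\subset\mathbb N$ with $\tilde\Gamma+\Delta\subset\Delta$ and $0,1,\dots,\mathrm{rk}-1\in\Delta$. A standard full increasing flag of length $\ell\ge 0$ is a chain $\vec\Delta=\{\Delta_0\subset\Delta_1\subset\dots\subset\Delta_\ell\}$ of standard $\tilde\Gamma$-modules with $\Delta_i=\Delta_{i-1}\cup\{g_i\}$, $g_i\notin\Delta_{i-1}$ $(1\le i\le\ell)$ and $g_1<g_2<\dots<g_\ell$. Let $\mathcal J^{\ell}_{\mathcal R,\mathrm{rk}}(\vec\Delta)$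 be the variety over $k$ of flags $\mathcal M_0\subset\dots\subset\mathcal M_\ell$ of $\mathcal R$-submodules of $\tilde{\mathcal O}$ with $\upsilon(\mathcal M_i\setminus\{0\})=\Delta_i$ for all $i$. Its structure is that of a locally closed subscheme of a product of Grassmannians of $\tilde{\mathcal O}/z^{c}\tilde{\mathcal O}$ for $c\gg0$: for a commutative $k$-algebra $A$, its $A$-points are the flags of $A[[z^p,z^q]]$-submodules $M_0\subset\dots\subset M_\ell$ of $A[[z^{1/\mathrm{rk}}]]$ such that, for all $i$ and $n$, the quotient $\{y\in M_i:\upsilon(y)\ge n\}/\{y\in M_i:\upsilon(y)\ge n+1\}$, viewed in $A\,z^{n/\mathrm{rk}}$, is $A\,z^{n/\mathrm{rk}}$ if $n\in\Delta_i$ and $0$ if $n\notin\Delta_i$. Write $\mathcal J_{\mathrm{rk}}(\Delta)$ for the case $\ell=0$, $\vec\Delta=\{\Delta\}$. For a standard $\tilde\Gamma$-module $\Delta$ and $g\in\mathbb N\setminus\Delta$ such that $\Delta\cup\{g\}$ is also a $\tilde\Gamma$-module, set $$\mu_{\Delta,g}=\dim \mathcal J^{1}_{\mathcal R,\mathrm{rk}}(\{\Delta\subset\Delta\cup\{g\}\})-\dim\mathcal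 J_{\mathrm{rk}}(\Delta),$$ and for $\Delta'\subset\mathbb N$ and $b\in\mathbb N$ put $\gamma_{\Delta'}(b)=|\{n\in\mathbb N: n\ge b,\ n\notin\Delta'\}|$. Theorem. (1) For every standard full increasing rank-$\mathrm{rk}$ flag $\vec\Delta$ of length $\ell\ge0$, the flagged cell $\mathcal J^{\ell}_{\mathcal R,\mathrm{rk}}(\vec\Delta)$ is biregularly isomorphic over $k$ to the affine space $\mathbb A^N$ with $$N=\dim\mathcal J_{\mathrm{rk}}(\Delta_0)+\sum_{i=0}^{\ell-1}\mu_{\Delta_i,g_{i+1}}.$$ (2) For every standard rank-$\mathrm{rk}$ $\tilde\Gamma$-module $\Delta$ and every $g\in\mathbb N\setminus\Delta$ such that $\Delta'=\Delta\cup\{g\}$ is a $\tilde\Gamma$-module, $$\mu_{\Delta,g}=\gamma_{\Delta'}(g)-\gamma_{\Delta'}(g+\mathrm{rk}\cdot p)-\bigl(\gamma_{\Delta'}(g+\mathrm{rk}\cdot q)-\gamma_{\Delta'}(g+\mathrm{rk}\cdot p+\mathrm{rk}\cdot q)\bigr).$$ -/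

import Mathlib

open CategoryTheory

universe u

namespace TorusCell

/-! The `z`-adic normalization `k⟦z⟧` is extended by `t = z ^ (1 / r)`, where `r` is the rank, so
that `k⟦z⟧ ^ r ≅ k⟦z⟧[z ^ (1 / r)] = k⟦t⟧`, with the valuation `υ (z ^ (j / r)) = j`, i.e. the
`t`-order. All power series below are series in the variable `t`. -/

/-- The semigroup `Γ̃ = r • (ℕ p + ℕ q) = υ (k⟦z ^ p, z ^ q⟧)`. -/
def semigroup (p q r : ℕ) : AddSubmonoid ℕ where
  carrier := {n | ∃ a b : ℕ, n = r * (a * p + b * q)}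
  zero_mem' := ⟨0, 0, by simp⟩
  add_mem' := by
    rintro _ _ ⟨a, b, rfl⟩ ⟨c, d, rfl⟩
    exact ⟨a + c, b + d, by ring⟩

/-- The ring `A⟦z ^ p, z ^ q⟧ ⊆ A⟦t⟧`, `z = t ^ r`: the power series whose exponents all lie in
`Γ̃`. -/
def torusRing (p q r : ℕ) (A : Type u) [CommRing A] : Subalgebra A (PowerSeries A) where
  carrier := {f | ∀ n, PowerSeries.coeff n f ≠ 0 → n ∈ semigroup p q r}
  mul_mem' := by
    intro f g hf hg n hn
    rw [PowerSeries.coeff_mul] at hn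
    obtain ⟨x, hx, hne⟩ := Finset.exists_ne_zero_of_sum_ne_zero hn
    rw [← Finset.HasAntidiagonal.mem_antidiagonal.mp hx]
    exact add_mem (hf _ (left_ne_zero_of_mul hne)) (hg _ (right_ne_zero_of_mul hne))
  add_mem' := by
    intro f g hf hg n hn
    by_cases h : PowerSeries.coeff n f = 0
    · exact hg n (by simpa [h] using hn)
    · exact hf n h
  algebraMap_mem' := by
    intro a n hn
    have h0 : n = 0 := by
      by_contra h
      exact hn (by
        rw [PowerSeries.algebraMap_apply, Algebra.algebraMap_self, RingHom.id_apply,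
          PowerSeries.coeff_C, if_neg h])
    subst h0
    exact zero_mem _

/-- `A⟦z ^ p, z ^ q⟧`-submodules of `A⟦t⟧`. -/
abbrev Mod (p q r : ℕ) (A : Type u) [CommRing A] := Submodule (torusRing p q r A) (PowerSeries A)

variable {p q r : ℕ}

/-- `υ (M) = Δ`, in the form that makes sense in families: for the filtration
`M ^ {n} = {y ∈ M | υ (y) ≥ n}`, the graded piece `M ^ {n} / M ^ {n + 1} ⊆ A t ^ n` is all of
`A t ^ n` if `n ∈ Δ`, and is `0` otherwise. Over a field this says exactly that `Δ` is the
set of orders of the nonzero elements of `M`, see `hasValuations_iff`. -/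
structure HasValuations {A : Type u} [CommRing A] (M : Mod p q r A) (Δ : Set ℕ) : Prop where
  jump : ∀ n ∈ Δ, ∃ y ∈ M, (∀ i < n, PowerSeries.coeff i y = 0) ∧ PowerSeries.coeff n y = 1
  gap : ∀ n, n ∉ Δ → ∀ y ∈ M, (∀ i < n, PowerSeries.coeff i y = 0) → PowerSeries.coeff n y = 0

theorem hasValuations_iff {K : Type u} [Field K] (M : Mod p q r K) (Δ : Set ℕ) :
    HasValuations M Δ ↔ Δ = {n : ℕ | ∃ y ∈ M, y.order = n} := by
  constructor
  · intro h
    ext n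
    constructor
    · intro hn
      obtain ⟨y, hy, h0, h1⟩ := h.jump n hn
      exact ⟨y, hy, PowerSeries.order_eq_nat.mpr ⟨by simp [h1], h0⟩⟩
    · rintro ⟨y, hy, ho⟩
      by_contra hn
      obtain ⟨h1, h0⟩ := PowerSeries.order_eq_nat.mp ho
      exact h1 (h.gap n hn y hy h0)
  · rintro rfl
    refine ⟨?_, ?_⟩
    · rintro n ⟨y, hy, ho⟩
      obtain ⟨h1, h0⟩ := PowerSeries.order_eq_nat.mp ho
      refine ⟨(algebraMap K (torusRing p q r K) (PowerSeries.coeff n y)⁻¹) • y,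
        M.smul_mem _ hy, ?_, ?_⟩
      · intro i hi
        rw [algebraMap_smul, PowerSeries.coeff_smul, h0 i hi, smul_zero]
      · rw [algebraMap_smul, PowerSeries.coeff_smul, smul_eq_mul, inv_mul_cancel₀ h1]
    · intro n hn y hy h0
      by_contra h1
      exact hn ⟨y, hy, PowerSeries.order_eq_nat.mpr ⟨h1, h0⟩⟩

/-- The base change of a module along `f : A → B`: the `B⟦z ^ p, z ^ q⟧`-submodule of `B⟦t⟧`
generated by the image of `M`. -/
noncomputable def baseChange {A B : Type u} [CommRing A] [CommRing B] (f : A →+* B) (M : Mod p q r A) :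
    Mod p q r B :=
  Submodule.span (torusRing p q r B) (PowerSeries.map f '' (M : Set (PowerSeries A)))

theorem baseChange_id {A : Type u} [CommRing A] (M : Mod p q r A) :
    baseChange (RingHom.id A) M = M := by
  simp [baseChange]

theorem map_mem_torusRing {A B : Type u} [CommRing A] [CommRing B] (f : A →+* B) {y : PowerSeries A}
    (hy : y ∈ torusRing p q r A) : PowerSeries.map f y ∈ torusRing p q r B := by
  intro n hn
  refine hy n fun h => hn ?_
  rw [PowerSeries.coeff_map, h, map_zero]

theorem baseChange_comp {A B C : Type u} [CommRing A] [CommRing B] [CommRing C] (f : A →+* B)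
    (g : B →+* C) (M : Mod p q r A) :
    baseChange (g.comp f) M = baseChange g (baseChange f M) := by
  apply le_antisymm
  · refine Submodule.span_le.mpr ?_
    rintro _ ⟨y, hy, rfl⟩
    refine Submodule.subset_span ⟨PowerSeries.map f y, Submodule.subset_span ⟨y, hy, rfl⟩, ?_⟩
    ext n
    simp
  · refine Submodule.span_le.mpr ?_
    rintro _ ⟨y, hy, rfl⟩
    refine Submodule.span_induction (p := fun y _ => PowerSeries.map g y ∈
      baseChange (g.comp f) M) ?_ ?_ ?_ ?_ hy
    · rintro _ ⟨x, hx, rfl⟩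
      refine Submodule.subset_span ⟨x, hx, ?_⟩
      ext n
      simp
    · simp
    · intro x y _ _ hx hy
      rw [map_add]
      exact add_mem hx hy
    · intro a x _ hx
      have : PowerSeries.map g (a • x) =
          (⟨PowerSeries.map g a, map_mem_torusRing g a.2⟩ : torusRing p q r C) • PowerSeries.map g x := by
        rw [Subalgebra.smul_def, Subalgebra.smul_def, smul_eq_mul, smul_eq_mul, map_mul]
      rw [this]
      exact Submodule.smul_mem _ _ hx

theorem baseChange_mono {A B : Type u} [CommRing A] [CommRing B] (f : A →+* B)
    {M N : Mod p q r A} (h : M ≤ N) : baseChange f M ≤ baseChange f N :=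
  Submodule.span_mono (Set.image_mono h)

theorem exists_combination {A : Type u} [CommRing A] {M : Mod p q r A} {Δ : Set ℕ}
    (h : HasValuations M Δ) (e : ℕ → PowerSeries A) (he : ∀ n ∈ Δ, e n ∈ M)
    (he0 : ∀ n ∈ Δ, ∀ i < n, PowerSeries.coeff i (e n) = 0)
    (he1 : ∀ n ∈ Δ, PowerSeries.coeff n (e n) = 1) {y : PowerSeries A} (hy : y ∈ M) (N : ℕ) :
    ∃ c : ℕ → A, (∀ n ∉ Δ, c n = 0) ∧ ∀ i < N,
      PowerSeries.coeff i y = ∑ n ∈ Finset.range N, c n * PowerSeries.coeff i (e n) := by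
  classical
  have key : ∃ c : ℕ → A, (∀ n ∉ Δ, c n = 0) ∧
      (y - ∑ n ∈ Finset.range N, c n • e n) ∈ M ∧
      ∀ i < N, PowerSeries.coeff i (y - ∑ n ∈ Finset.range N, c n • e n) = 0 := by
    induction N with
    | zero => exact ⟨0, by simp, by simpa using hy, by simp⟩
    | succ N ih =>
      obtain ⟨c, hc, hM, h0⟩ := ih
      set y' := y - ∑ n ∈ Finset.range N, c n • e n with hy'
      have hsum : ∀ a : A, y - ∑ n ∈ Finset.range (N + 1), Function.update c N a n • e n =
          y' - a • e N := by
        intro a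
        rw [Finset.sum_range_succ, Function.update_self, hy', sub_sub]
        congr 2
        refine Finset.sum_congr rfl fun n hn => ?_
        rw [Function.update_of_ne (Finset.mem_range.mp hn).ne]
      by_cases hN : N ∈ Δ
      · refine ⟨Function.update c N (PowerSeries.coeff N y'), ?_, ?_, ?_⟩
        · intro n hn
          rw [Function.update_of_ne (by rintro rfl; exact hn hN)]
          exact hc n hn
        · rw [hsum, ← algebraMap_smul (torusRing p q r A)]
          exact sub_mem hM (M.smul_mem _ (he N hN))
        · intro i hi
          rw [hsum, map_sub, PowerSeries.coeff_smul]
          rcases Nat.lt_succ_iff_lt_or_eq.mp hi with hi | rfl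
          · rw [h0 i hi, he0 N hN i hi, smul_zero, sub_zero]
          · rw [he1 i hN, smul_eq_mul, mul_one, sub_self]
      · refine ⟨Function.update c N 0, ?_, ?_, ?_⟩
        · intro n hn
          by_cases hnN : n = N
          · rw [hnN, Function.update_self]
          · rw [Function.update_of_ne hnN]
            exact hc n hn
        · rw [hsum, zero_smul, sub_zero]
          exact hM
        · intro i hi
          rw [hsum, zero_smul, sub_zero]
          rcases Nat.lt_succ_iff_lt_or_eq.mp hi with hi | rfl
          · exact h0 i hi
          · exact h.gap i hN y' hM h0
  obtain ⟨c, hc, -, h0⟩ := key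
  refine ⟨c, hc, fun i hi => ?_⟩
  have := h0 i hi
  rw [map_sub, sub_eq_zero, map_sum] at this
  simpa using this

theorem HasValuations.baseChange {A B : Type u} [CommRing A] [CommRing B] (f : A →+* B)
    {M : Mod p q r A} {Δ : Set ℕ} (h : HasValuations M Δ) :
    HasValuations (baseChange f M) Δ := by
  classical
  have hex : ∀ n, ∃ y : PowerSeries A, n ∈ Δ → y ∈ M ∧ (∀ i < n, PowerSeries.coeff i y = 0) ∧
      PowerSeries.coeff n y = 1 := by
    intro n
    by_cases hn : n ∈ Δ
    · obtain ⟨y, hy⟩ := h.jump n hn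
      exact ⟨y, fun _ => hy⟩
    · exact ⟨0, fun h => absurd h hn⟩
  choose e he using hex
  refine ⟨?_, ?_⟩
  · intro n hn
    obtain ⟨hM, h0, h1⟩ := he n hn
    refine ⟨PowerSeries.map f (e n), Submodule.subset_span ⟨_, hM, rfl⟩, ?_, ?_⟩
    · intro i hi
      rw [PowerSeries.coeff_map, h0 i hi, map_zero]
    · rw [PowerSeries.coeff_map, h1, map_one]
  · intro N hN y hy h0
    have key : ∃ c : ℕ → B, (∀ n ∉ Δ, c n = 0) ∧ ∀ i < N + 1, PowerSeries.coeff i y =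
        ∑ n ∈ Finset.range (N + 1), c n * f (PowerSeries.coeff i (e n)) := by
      -- stronger induction hypothesis: all multiples by elements of the ring
      have main : ∀ x ∈ M, ∃ c : ℕ → B, (∀ n ∉ Δ, c n = 0) ∧ ∀ i < N + 1,
          f (PowerSeries.coeff i x) =
            ∑ n ∈ Finset.range (N + 1), c n * f (PowerSeries.coeff i (e n)) := by
        intro x hx
        obtain ⟨c, hc, hx⟩ := exists_combination h e (fun n hn => (he n hn).1)
          (fun n hn => (he n hn).2.1) (fun n hn => (he n hn).2.2) hx (N + 1)
        refine ⟨fun n => f (c n), fun n hn => by simp [hc n hn], fun i hi => ?_⟩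
        rw [hx i hi, map_sum]
        simp
      have mon : ∀ x ∈ M, ∀ m ∈ semigroup p q r, PowerSeries.X ^ m * x ∈ M := by
        intro x hx m hm
        refine M.smul_mem (⟨PowerSeries.X ^ m, ?_⟩ : torusRing p q r A) hx
        intro n hn
        rw [PowerSeries.coeff_X_pow] at hn
        have : n = m := by
          by_contra hnm
          exact hn (if_neg hnm)
        rwa [this]
      -- the span consists, modulo `t ^ (N + 1)`, of `B`-combinations of images of `M`
      have base : ∀ x ∈ M, ∀ s ∈ torusRing p q r B, ∃ c : ℕ → B, (∀ n ∉ Δ, c n = 0) ∧ ∀ i < N + 1,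
          PowerSeries.coeff i (s * PowerSeries.map f x) =
            ∑ n ∈ Finset.range (N + 1), c n * f (PowerSeries.coeff i (e n)) := by
        intro x hx s hs
        have hd : ∀ m, ∃ d : ℕ → B, (∀ n ∉ Δ, d n = 0) ∧ (m ∈ semigroup p q r → ∀ i < N + 1,
            f (PowerSeries.coeff i (PowerSeries.X ^ m * x)) =
            ∑ n ∈ Finset.range (N + 1), d n * f (PowerSeries.coeff i (e n))) := by
          intro m
          by_cases hm : m ∈ semigroup p q r
          · obtain ⟨d, hd, hd'⟩ := main _ (mon x hx m hm)
            exact ⟨d, hd, fun _ => hd'⟩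
          · exact ⟨0, by simp, fun h => absurd h hm⟩
        choose d hd0 hd using hd
        refine ⟨fun n => ∑ m ∈ Finset.range (N + 1), PowerSeries.coeff m s * d m n, ?_, ?_⟩
        · intro n hn
          exact Finset.sum_eq_zero fun m _ => by rw [hd0 m n hn, mul_zero]
        · intro i hi
          have h1 : PowerSeries.coeff i (s * PowerSeries.map f x) =
              ∑ m ∈ Finset.range (N + 1), PowerSeries.coeff m s *
                f (PowerSeries.coeff i (PowerSeries.X ^ m * x)) := by
            rw [PowerSeries.coeff_mul, Finset.Nat.sum_antidiagonal_eq_sum_range_succ_mk]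
            have hsub : Finset.range (i + 1) ⊆ Finset.range (N + 1) :=
              Finset.range_mono (by omega)
            rw [← Finset.sum_subset hsub]
            · refine Finset.sum_congr rfl fun m hm => ?_
              rw [PowerSeries.coeff_X_pow_mul', if_pos (by simpa [Nat.lt_succ_iff] using hm),
                PowerSeries.coeff_map]
            · intro m _ hm
              rw [PowerSeries.coeff_X_pow_mul', if_neg (by simpa [Nat.lt_succ_iff] using hm),
                map_zero, mul_zero]
          rw [h1]
          have h2 : ∀ m ∈ Finset.range (N + 1), PowerSeries.coeff m s *
                f (PowerSeries.coeff i (PowerSeries.X ^ m * x)) =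
              ∑ n ∈ Finset.range (N + 1),
                PowerSeries.coeff m s * d m n * f (PowerSeries.coeff i (e n)) := by
            intro m _
            by_cases hm : PowerSeries.coeff m s = 0
            · simp [hm]
            · rw [hd m (hs m hm) i hi, Finset.mul_sum]
              exact Finset.sum_congr rfl fun n _ => by ring
          rw [Finset.sum_congr rfl h2, Finset.sum_comm]
          exact Finset.sum_congr rfl fun n _ => by rw [Finset.sum_mul]
      have all : ∀ s ∈ torusRing p q r B, ∃ c : ℕ → B, (∀ n ∉ Δ, c n = 0) ∧ ∀ i < N + 1,
          PowerSeries.coeff i (s * y) =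
            ∑ n ∈ Finset.range (N + 1), c n * f (PowerSeries.coeff i (e n)) := by
        refine Submodule.span_induction (p := fun y _ => ∀ s ∈ torusRing p q r B, ∃ c : ℕ → B,
          (∀ n ∉ Δ, c n = 0) ∧ ∀ i < N + 1, PowerSeries.coeff i (s * y) =
            ∑ n ∈ Finset.range (N + 1), c n * f (PowerSeries.coeff i (e n))) ?_ ?_ ?_ ?_ hy
        · rintro _ ⟨x, hx, rfl⟩
          exact base x hx
        · exact fun s _ => ⟨0, by simp, by simp⟩
        · intro x y _ _ hx hy s hs
          obtain ⟨c, hc, hc'⟩ := hx s hs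
          obtain ⟨d, hd, hd'⟩ := hy s hs
          refine ⟨c + d, fun n hn => by simp [hc n hn, hd n hn], fun i hi => ?_⟩
          rw [mul_add, map_add, hc' i hi, hd' i hi, ← Finset.sum_add_distrib]
          exact Finset.sum_congr rfl fun n _ => by rw [Pi.add_apply, add_mul]
        · intro a x _ hx s hs
          obtain ⟨c, hc, hc'⟩ := hx (s * a) (mul_mem hs a.2)
          refine ⟨c, hc, fun i hi => ?_⟩
          rw [Subalgebra.smul_def, smul_eq_mul, ← mul_assoc]
          exact hc' i hi
      obtain ⟨c, hc, hc'⟩ := all 1 (one_mem _)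
      exact ⟨c, hc, by simpa using hc'⟩
    obtain ⟨c, hc, hy'⟩ := key
    have hzero : ∀ n < N + 1, c n = 0 := by
      intro n
      induction n using Nat.strong_induction_on with
      | _ n ih =>
        intro hn
        by_cases hnΔ : n ∈ Δ
        · have hnN : n < N := lt_of_le_of_ne (Nat.lt_succ_iff.mp hn)
            (by rintro rfl; exact hN hnΔ)
          have h1 := hy' n hn
          rw [h0 n hnN, Finset.sum_eq_single n] at h1
          · simpa [(he n hnΔ).2.2] using h1.symm
          · intro m hm hmn
            rcases lt_or_gt_of_ne hmn with hlt | hgt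
            · rw [ih m hlt (Finset.mem_range.mp hm), zero_mul]
            · by_cases hmΔ : m ∈ Δ
              · rw [(he m hmΔ).2.1 n hgt, map_zero, mul_zero]
              · rw [hc m hmΔ, zero_mul]
          · intro h
            exact absurd (Finset.mem_range.mpr hn) h
        · exact hc n hnΔ
    rw [hy' N (Nat.lt_succ_self N)]
    exact Finset.sum_eq_zero fun n hn => by rw [hzero n (Finset.mem_range.mp hn), zero_mul]

/-- The `A`-points of the flagged cell of `Δ 0 ⊆ ⋯ ⊆ Δ ℓ`: the flags `M 0 ⊆ ⋯ ⊆ M ℓ` of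
`A⟦z ^ p, z ^ q⟧`-submodules of `A⟦t⟧` with `υ (M i) = Δ i`. -/
@[ext]
structure FlagPoint (p q r : ℕ) {ℓ : ℕ} (Δ : Fin (ℓ + 1) → Set ℕ) (A : Type u) [CommRing A] where
  M : Fin (ℓ + 1) → Mod p q r A
  mono : Monotone M
  valuations : ∀ i, HasValuations (M i) (Δ i)

/-- Base change of flags. -/
noncomputable def FlagPoint.map {ℓ : ℕ} {Δ : Fin (ℓ + 1) → Set ℕ} {A B : Type u} [CommRing A] [CommRing B]
    (f : A →+* B) (x : FlagPoint p q r Δ A) : FlagPoint p q r Δ B where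
  M i := baseChange f (x.M i)
  mono _ _ h := baseChange_mono f (x.mono h)
  valuations i := (x.valuations i).baseChange f

theorem FlagPoint.map_id {ℓ : ℕ} {Δ : Fin (ℓ + 1) → Set ℕ} {A : Type u} [CommRing A]
    (x : FlagPoint p q r Δ A) : x.map (RingHom.id A) = x :=
  FlagPoint.ext (funext fun i => baseChange_id (x.M i))

theorem FlagPoint.map_comp {ℓ : ℕ} {Δ : Fin (ℓ + 1) → Set ℕ} {A B C : Type u} [CommRing A]
    [CommRing B] [CommRing C] (f : A →+* B) (g : B →+* C) (x : FlagPoint p q r Δ A) :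
    x.map (g.comp f) = (x.map f).map g :=
  FlagPoint.ext (funext fun i => baseChange_comp f g (x.M i))

/-- The flagged cell `J ^ ℓ (Δ 0, …, Δ ℓ)` of `k⟦z ^ p, z ^ q⟧` in rank `r`, as a locally closed
subscheme of a product of Grassmannians of `k⟦t⟧ / t ^ c k⟦t⟧`, `c` large, given by its functor
of points on commutative `k`-algebras. -/
noncomputable def flagCell (k : Type u) [Field k] (p q r : ℕ) {ℓ : ℕ} (Δ : Fin (ℓ + 1) → Set ℕ) :
    CommAlgCat.{u} k ⥤ Type u where
  obj A := FlagPoint p q r Δ A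
  map f := ↾fun x => x.map f.hom.toRingHom
  map_id _ := ConcreteCategory.hom_ext _ _ fun x => x.map_id
  map_comp f g := ConcreteCategory.hom_ext _ _ fun x => x.map_comp f.hom.toRingHom g.hom.toRingHom

/-- The unflagged cell `J (Δ)`. -/
noncomputable abbrev cell (k : Type u) [Field k] (p q r : ℕ) (Δ : Set ℕ) : CommAlgCat.{u} k ⥤ Type u :=
  flagCell k p q r ![Δ]

/-- `X` (given by its functor of points) is isomorphic over `k` to the affine space `𝔸 ^ N`. -/
def IsAffineSpace {k : Type u} [Field k] (X : CommAlgCat.{u} k ⥤ Type u) (N : ℕ) : Prop :=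
  Nonempty (X.CorepresentableBy (CommAlgCat.of k (MvPolynomial (Fin N) k)))

open Classical in
/-- The dimension of an affine `k`-scheme `X` given by its functor of points: the Krull dimension
of its coordinate ring. -/
noncomputable def dim {k : Type u} [Field k] (X : CommAlgCat.{u} k ⥤ Type u) : WithBot ℕ∞ :=
  if _h : X.IsCorepresentable then ringKrullDim X.coreprX else ⊥

/-- The dimension as an integer (used for finite-dimensional nonempty `X`). -/
noncomputable def dimInt {k : Type u} [Field k] (X : CommAlgCat.{u} k ⥤ Type u) : ℤ :=
  (((dim X).unbotD 0).toNat : ℤ)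

/-- `Δ` is a module over `Γ̃`. -/
def IsModule (p q r : ℕ) (Δ : Set ℕ) : Prop :=
  ∀ γ ∈ semigroup p q r, ∀ x ∈ Δ, γ + x ∈ Δ

/-- A standard (rank-`r`) `Γ̃`-module: it contains `0, 1, …, r - 1`. -/
structure IsStandard (p q r : ℕ) (Δ : Set ℕ) : Prop where
  isModule : IsModule p q r Δ
  standard : ∀ j < r, j ∈ Δ

/-- A standard full increasing flag `Δ 0 ⊂ ⋯ ⊂ Δ ℓ` of `Γ̃`-modules of rank `r`. Here
`g i` is the element added to `Δ i` to get `Δ (i + 1)`. -/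
structure IsStandardFlag (p q r : ℕ) {ℓ : ℕ} (Δ : Fin (ℓ + 1) → Set ℕ) (g : Fin ℓ → ℕ) :
    Prop where
  isStandard : ∀ i, IsStandard p q r (Δ i)
  notMem : ∀ i, g i ∉ Δ i.castSucc
  step : ∀ i, Δ i.succ = Δ i.castSucc ∪ {g i}
  strictMono : StrictMono g

/-- The gap counting function `γ_Δ (b) = |[b, ∞) \ Δ|`. -/
noncomputable def gaps (Δ : Set ℕ) (b : ℕ) : ℤ := ((Set.Ici b \ Δ).ncard : ℤ)

/-- The dimension change `μ_{Δ, g} = dim J ^ 1 (Δ, Δ ∪ {g}) - dim J (Δ)`. -/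
noncomputable def dimChange (k : Type u) [Field k] (p q r : ℕ) (Δ : Set ℕ) (g : ℕ) : ℤ :=
  dimInt (flagCell k p q r ![Δ, Δ ∪ {g}]) - dimInt (cell k p q r Δ)

end TorusCell

/-! Write `P = r * p`, `Q = r * q`, `D = Δ 0` and `E = Δ (Fin.last ℓ)`. Since the `g i` increase,
every `n ∈ E` is born in some `Δ β` all of whose elements above `n` lie in `D`. Hence a flag
contains exactly one series `f_n = t ^ n + ∑ l n m t ^ m`, with `m > n` outside `D`, belonging to
every `M i` with `n ∈ Δ i`; moreover `t ^ P f_n` and `t ^ Q f_n` fall into `M 0`. Flags thus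
correspond to those `l` for which division of these products by the `f_m`, `m ∈ D`, leaves remainder
zero (`solves_coordinate`, `Solves.toFlagPoint`).

Give `l n m` the degree `s = m - n`. Modulo lower degrees the equations are linear: they prescribe
the differences of `n ↦ l n (n + s)` along the steps `n → n + P` and `n → n + Q`, as long as the
endpoint plus `s` is outside `D`. Because `t ^ P` and `t ^ Q` commute, the prescribed differences
form a cocycle, so they integrate to a potential (`exists_potential`), unique once its values are
fixed at the `n ∉ E + P` with `n + s ∉ D` and `n + s + Q ∈ D` (`potential_eq_zero`). By induction on
`s`, the coordinates in `freeIndices` can be chosen arbitrarily and determine the others, over every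
ring and compatibly with base change. The cell is therefore an affine space.

For the dimension, adding `g` to `E` replaces the generator `g + P` by `g`, and the free `m` over
`n` are counted by the gaps of `D` above `n` minus those above `n + Q`. This gives the formula for
`dimChange`. It sees only gaps above `g i`, where `Δ 0` and `Δ i.succ` agree, so taking `Δ 0` or `Δ
i.castSucc` for `D` gives the same increment, and the increments telescope. -/

namespace TorusCell

/-! ### Potentials with prescribed differences along two commuting translations -/

/-- The elements of `X` that are not of the form `m + P` with `m ∈ X`. -/
def IsGen (P : ℕ) (X : Set ℕ) (n : ℕ) : Prop := n ∈ X ∧ ∀ m ∈ X, m + P ≠ n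

/-- Along each string `n, n + P, …` the potential is forced by its value at the generator, which is
carried over from `n + Q` when that lies in `Y` and is free otherwise. The recursion terminates
lexicographically: a `Q`-step into `Y` lowers `ρ`, and going back by `P` keeps `ρ` and lowers `n`.
The `Q`-relation holds at generators by construction, and the cocycle condition `huv` transports it
along the string. -/
theorem exists_potential {A : Type*} [AddCommGroup A] {X Y : Set ℕ} {P Q : ℕ} (hP : 0 < P)
    (hXQ : ∀ n ∈ X, n + Q ∈ X) (hYP : ∀ n, n + P ∈ Y → n ∈ Y) (ρ : ℕ → ℕ)
    (hρP : ∀ n, ρ (n + P) = ρ n) (hρQ : ∀ n, n + Q ∈ Y → ρ (n + Q) < ρ n) (u v c : ℕ → A)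
    (huv : ∀ n ∈ X, n + P + Q ∈ Y → u n + v (n + P) = v n + u (n + Q)) :
    ∃ μ : ℕ → A, (∀ n ∈ X, n + P ∈ Y → μ n = μ (n + P) + u n) ∧
      (∀ n ∈ X, n + Q ∈ Y → μ n = μ (n + Q) + v n) ∧
      ∀ n, IsGen P X n → n + Q ∉ Y → μ n = c n := by
  classical
  have wf : WellFounded (InvImage (Prod.Lex (· < ·) (· < ·)) fun n : ℕ => (ρ n, n)) :=
    InvImage.wf _ (WellFounded.prod_lex wellFounded_lt wellFounded_lt)
  have hdec : ∀ n, P ≤ n → (InvImage (Prod.Lex (· < ·) (· < ·)) fun n : ℕ => (ρ n, n)) (n - P) n := by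
    intro n hn
    have h : ρ (n - P) = ρ n := by
      rw [← hρP (n - P), Nat.sub_add_cancel hn]
    change Prod.Lex _ _ (ρ (n - P), n - P) (ρ n, n)
    rw [h]
    exact Prod.Lex.right _ (by omega)
  let step : (n : ℕ) → ((m : ℕ) → (InvImage (Prod.Lex (· < ·) (· < ·))
      fun n : ℕ => (ρ n, n)) m n → A) → A := fun n rec =>
    if h : P ≤ n ∧ n - P ∈ X then rec (n - P) (hdec n h.1) - u (n - P)
    else if h : n + Q ∈ Y then rec (n + Q) (Prod.Lex.left _ _ (hρQ n h)) + v n else c n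
  have hfix : ∀ n, wf.fix step n = if P ≤ n ∧ n - P ∈ X then wf.fix step (n - P) - u (n - P)
      else if n + Q ∈ Y then wf.fix step (n + Q) + v n else c n := by
    intro n
    rw [wf.fix_eq]
    simp only [step, dite_eq_ite]
  generalize wf.fix step = μ at hfix
  have hgen : ∀ n, IsGen P X n → ¬ (P ≤ n ∧ n - P ∈ X) := fun n hn h =>
    hn.2 _ h.2 (Nat.sub_add_cancel h.1)
  have hx : ∀ n ∈ X, μ (n + P) = μ n - u n := by
    intro n hn
    rw [hfix (n + P), if_pos (by simpa using hn), Nat.add_sub_cancel]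
  refine ⟨μ, fun n hn _ => by rw [hx n hn, sub_add_cancel], ?_, ?_⟩
  · intro n
    induction n using Nat.strong_induction_on with
    | _ n ih =>
      intro hn hnQ
      by_cases hg : IsGen P X n
      · rw [hfix n, if_neg (hgen n hg), if_pos hnQ]
      · obtain ⟨m, hm, rfl⟩ : ∃ m ∈ X, m + P = n := by
          by_contra! h
          exact hg ⟨hn, h⟩
        have h1 := ih m (by omega) hm (hYP _ (by rwa [add_right_comm]))
        have h2 := huv m hm hnQ
        rw [add_right_comm, hx m hm, hx _ (hXQ m hm), h1]
        have h3 : v (m + P) = v m + u (m + Q) - u m := by rw [← h2]; abel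
        rw [h3]
        abel
  · intro n hn hnQ
    rw [hfix n, if_neg (hgen n hn), if_neg hnQ]

/-- The same recursion read as uniqueness: a potential with zero differences is carried back along
`P` to a generator and then along `Q`, until a free vertex is reached. -/
theorem potential_eq_zero {A : Type*} [AddCommGroup A] {X Y : Set ℕ} {P Q : ℕ} (hP : 0 < P)
    (hXQ : ∀ n ∈ X, n + Q ∈ X) (hYP : ∀ n, n + P ∈ Y → n ∈ Y) (ρ : ℕ → ℕ)
    (hρP : ∀ n, ρ (n + P) = ρ n) (hρQ : ∀ n, n + Q ∈ Y → ρ (n + Q) < ρ n) (μ : ℕ → A)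
    (hμP : ∀ n ∈ X, n + P ∈ Y → μ n = μ (n + P)) (hμQ : ∀ n ∈ X, n + Q ∈ Y → μ n = μ (n + Q))
    (h0 : ∀ n ∈ Y, IsGen P X n → n + Q ∉ Y → μ n = 0) : ∀ n ∈ X, n ∈ Y → μ n = 0 := by
  suffices h : ∀ a n, ρ n = a → n ∈ X → n ∈ Y → μ n = 0 from fun n => h _ n rfl
  intro a
  induction a using Nat.strong_induction_on with
  | _ a iha =>
    intro n
    induction n using Nat.strong_induction_on with
    | _ n ihn =>
      intro ha hX hY
      by_cases hg : IsGen P X n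
      · by_cases hQ : n + Q ∈ Y
        · rw [hμQ n hX hQ]
          exact iha _ (ha ▸ hρQ n hQ) _ rfl (hXQ n hX) hQ
        · exact h0 n hY hg hQ
      · obtain ⟨m, hm, rfl⟩ : ∃ m ∈ X, m + P = n := by
          by_contra! h
          exact hg ⟨hX, h⟩
        rw [← hμP m hm hY]
        exact ihn m (by omega) (by rw [← hρP, ha]) hm (hYP m hY)

/-! ### Division by series with leading exponents in `D` -/

section Reduction

variable {A : Type u} [CommRing A]

open Classical in
/-- The series `t ^ n + ∑ l n m t ^ m`, the sum running over `m > n` outside `D`. -/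
noncomputable def monicSeries (D : Set ℕ) (l : ℕ → ℕ → A) (n : ℕ) : PowerSeries A :=
  PowerSeries.mk fun m => if m = n then 1 else if n < m ∧ m ∉ D then l n m else 0

open Classical in
/-- The remainder of `y` after subtracting `coeff m y • monicSeries D l m` for all `m ∈ D`. -/
noncomputable def reduction (D : Set ℕ) (l : ℕ → ℕ → A) : PowerSeries A →ₗ[A] PowerSeries A where
  -- One pass suffices: each divisor vanishes at all exponents of `D` except its own leading one, so
  -- the quotients are the coefficients of `y` itself.
  toFun y := PowerSeries.mk fun N => if N ∈ D then 0 else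
    PowerSeries.coeff N y - ∑ m ∈ Finset.range N with m ∈ D, PowerSeries.coeff m y * l m N
  map_add' x y := by
    ext N
    by_cases h : N ∈ D
    · simp [h]
    · simp only [PowerSeries.coeff_mk, map_add, if_neg h, add_mul, Finset.sum_add_distrib]
      ring
  map_smul' a y := by
    ext N
    by_cases h : N ∈ D
    · simp [h]
    · simp only [PowerSeries.coeff_mk, map_smul, if_neg h, smul_eq_mul, RingHom.id_apply, mul_sub,
        Finset.mul_sum, mul_assoc]

variable {D : Set ℕ} {l : ℕ → ℕ → A}

theorem coeff_monicSeries_self (n : ℕ) : PowerSeries.coeff n (monicSeries D l n) = 1 := by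
  simp [monicSeries]

theorem coeff_monicSeries_of_lt {m n : ℕ} (h : m < n) :
    PowerSeries.coeff m (monicSeries D l n) = 0 := by
  rw [monicSeries, PowerSeries.coeff_mk, if_neg h.ne, if_neg fun h' => by omega]

theorem coeff_monicSeries_of_mem {m n : ℕ} (h : m ∈ D) (hmn : m ≠ n) :
    PowerSeries.coeff m (monicSeries D l n) = 0 := by
  rw [monicSeries, PowerSeries.coeff_mk, if_neg hmn, if_neg fun h' => h'.2 h]

theorem coeff_monicSeries_of_notMem {m n : ℕ} (h : m ∉ D) (hmn : n < m) :
    PowerSeries.coeff m (monicSeries D l n) = l n m := by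
  rw [monicSeries, PowerSeries.coeff_mk, if_neg hmn.ne', if_pos ⟨hmn, h⟩]

theorem coeff_reduction_of_mem {N : ℕ} (h : N ∈ D) (y : PowerSeries A) :
    PowerSeries.coeff N (reduction D l y) = 0 := by
  simp [reduction, h]

open Classical in
theorem coeff_reduction_of_notMem {N : ℕ} (h : N ∉ D) (y : PowerSeries A) :
    PowerSeries.coeff N (reduction D l y) = PowerSeries.coeff N y -
      ∑ m ∈ Finset.range N with m ∈ D, PowerSeries.coeff m y * l m N := by
  simp [reduction, h]

theorem coeff_reduction_congr {N : ℕ} {y y' : PowerSeries A}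
    (h : ∀ j ≤ N, PowerSeries.coeff j y = PowerSeries.coeff j y') :
    PowerSeries.coeff N (reduction D l y) = PowerSeries.coeff N (reduction D l y') := by
  classical
  by_cases hN : N ∈ D
  · rw [coeff_reduction_of_mem hN, coeff_reduction_of_mem hN]
  · rw [coeff_reduction_of_notMem hN, coeff_reduction_of_notMem hN, h N le_rfl]
    congr 1
    refine Finset.sum_congr rfl fun m hm => ?_
    rw [h m (Finset.mem_range.mp (Finset.mem_filter.mp hm).1).le]

theorem coeff_reduction_of_forall_lt {N : ℕ} {y : PowerSeries A}
    (h : ∀ j < N, PowerSeries.coeff j y = 0) (hN : N ∉ D) :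
    PowerSeries.coeff N (reduction D l y) = PowerSeries.coeff N y := by
  classical
  rw [coeff_reduction_of_notMem hN, Finset.sum_eq_zero, sub_zero]
  intro m hm
  rw [h m (Finset.mem_range.mp (Finset.mem_filter.mp hm).1), zero_mul]

theorem coeff_reduction_eq_zero {N : ℕ} {y : PowerSeries A}
    (h : ∀ j ≤ N, PowerSeries.coeff j y = 0) : PowerSeries.coeff N (reduction D l y) = 0 := by
  rw [coeff_reduction_congr (y' := 0) (by simpa using h), map_zero, map_zero]

open Classical in
/-- Division of `y` by the series `monicSeries D l m`, `m ∈ D`, modulo `t ^ C`. -/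
theorem coeff_eq_sum_add_reduction {N C : ℕ} (hN : N < C) (y : PowerSeries A) :
    PowerSeries.coeff N y = PowerSeries.coeff N ((∑ m ∈ Finset.range C with m ∈ D,
      PowerSeries.coeff m y • monicSeries D l m) + reduction D l y) := by
  rw [map_add, map_sum]
  simp only [map_smul, smul_eq_mul]
  by_cases h : N ∈ D
  · rw [coeff_reduction_of_mem h, add_zero, Finset.sum_eq_single N]
    · rw [coeff_monicSeries_self, mul_one]
    · intro m _ hm
      rw [coeff_monicSeries_of_mem h hm.symm, mul_zero]
    · intro h'
      exact absurd (Finset.mem_filter.mpr ⟨Finset.mem_range.mpr hN, h⟩) h'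
  · rw [coeff_reduction_of_notMem h]
    have : ∑ m ∈ Finset.range C with m ∈ D, PowerSeries.coeff m y *
        PowerSeries.coeff N (monicSeries D l m) =
        ∑ m ∈ Finset.range N with m ∈ D, PowerSeries.coeff m y * l m N := by
      symm
      refine Finset.sum_subset_zero_on_sdiff ?_ ?_ ?_
      · exact Finset.filter_subset_filter _ (Finset.range_mono hN.le)
      · intro m hm
        simp only [Finset.mem_sdiff, Finset.mem_filter, Finset.mem_range] at hm
        have hne : m ≠ N := by rintro rfl; exact h hm.1.2
        rw [coeff_monicSeries_of_lt (by by_contra; exact hm.2 ⟨by omega, hm.1.2⟩), mul_zero]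
      · intro m hm
        simp only [Finset.mem_filter, Finset.mem_range] at hm
        rw [coeff_monicSeries_of_notMem h hm.1]
    rw [this]
    ring

theorem coeff_X_pow_mul_congr {N δ : ℕ} {y y' : PowerSeries A}
    (h : ∀ j ≤ N, PowerSeries.coeff j y = PowerSeries.coeff j y') :
    PowerSeries.coeff N (PowerSeries.X ^ δ * y) = PowerSeries.coeff N (PowerSeries.X ^ δ * y') := by
  rw [PowerSeries.coeff_X_pow_mul', PowerSeries.coeff_X_pow_mul']
  split_ifs
  · exact h _ (Nat.sub_le _ _)
  · rfl

open Classical in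
theorem coeff_reduction_X_pow_mul (δ N : ℕ) (y : PowerSeries A) :
    PowerSeries.coeff N (reduction D l (PowerSeries.X ^ δ * y)) =
      (∑ m ∈ Finset.range (N + 1) with m ∈ D, PowerSeries.coeff m y *
        PowerSeries.coeff N (reduction D l (PowerSeries.X ^ δ * monicSeries D l m))) +
      PowerSeries.coeff N (reduction D l (PowerSeries.X ^ δ * reduction D l y)) := by
  rw [coeff_reduction_congr (fun j hj => coeff_X_pow_mul_congr fun i hi =>
    coeff_eq_sum_add_reduction (C := N + 1) (D := D) (l := l) (by omega) y)]
  rw [mul_add, map_add, map_add, Finset.mul_sum, map_sum, map_sum]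
  congr 1
  refine Finset.sum_congr rfl fun m _ => ?_
  rw [mul_smul_comm, map_smul, map_smul, smul_eq_mul]

theorem coeff_X_pow_mul_of_lt {δ N b : ℕ} {y : PowerSeries A}
    (h : ∀ j < b, PowerSeries.coeff j y = 0) (hN : N < b + δ) :
    PowerSeries.coeff N (PowerSeries.X ^ δ * y) = 0 := by
  rw [PowerSeries.coeff_X_pow_mul']
  split_ifs
  · exact h _ (by omega)
  · rfl

theorem coeff_reduction_X_pow_mul_monicSeries_of_le {n γ N : ℕ} (hn : n + γ ∈ D)
    (hN : N ≤ n + γ) :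
    PowerSeries.coeff N (reduction D l (PowerSeries.X ^ γ * monicSeries D l n)) = 0 := by
  rcases hN.lt_or_eq with h | rfl
  · exact coeff_reduction_eq_zero fun j hj =>
      coeff_X_pow_mul_of_lt (fun i hi => coeff_monicSeries_of_lt hi) (by omega)
  · exact coeff_reduction_of_mem hn _

/-- The leading defects form a cocycle. -/
theorem coeff_reduction_X_pow_mul_X_pow_mul {n γ δ s : ℕ} (hn : n + γ ∈ D)
    (hN : n + γ + δ + s ∉ D)
    (h1 : ∀ N < n + γ + s,
      PowerSeries.coeff N (reduction D l (PowerSeries.X ^ γ * monicSeries D l n)) = 0)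
    (h2 : ∀ m ∈ D, ∀ N < m + δ + s,
      PowerSeries.coeff N (reduction D l (PowerSeries.X ^ δ * monicSeries D l m)) = 0) :
    PowerSeries.coeff (n + γ + δ + s) (reduction D l (PowerSeries.X ^ δ *
      (PowerSeries.X ^ γ * monicSeries D l n))) =
    PowerSeries.coeff (n + γ + δ + s) (reduction D l (PowerSeries.X ^ δ *
      monicSeries D l (n + γ))) +
    PowerSeries.coeff (n + γ + s) (reduction D l (PowerSeries.X ^ γ * monicSeries D l n)) := by
  classical
  -- Divide `t ^ γ f_n` by the `f_m` before multiplying by `t ^ δ`. The remainder starts no earlier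
  -- than degree `s`, so only its leading coefficient, shifted by `δ`, is seen here.
  have hlast : PowerSeries.coeff (n + γ + δ + s) (reduction D l (PowerSeries.X ^ δ *
      reduction D l (PowerSeries.X ^ γ * monicSeries D l n))) =
      PowerSeries.coeff (n + γ + s) (reduction D l (PowerSeries.X ^ γ * monicSeries D l n)) := by
    rw [coeff_reduction_of_forall_lt _ hN, add_right_comm (n + γ), PowerSeries.coeff_X_pow_mul]
    exact fun j hj => coeff_X_pow_mul_of_lt h1 (by omega)
  rw [coeff_reduction_X_pow_mul, hlast, Finset.sum_eq_single (n + γ)]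
  · rw [PowerSeries.coeff_X_pow_mul, coeff_monicSeries_self, one_mul]
  -- Quotients below `n + γ` vanish, and the defect of an `f_m` with `m > n + γ` begins beyond the
  -- coefficient considered.
  · intro m hm hne
    rcases lt_or_gt_of_ne hne with h | h
    · rw [coeff_X_pow_mul_of_lt (fun i hi => coeff_monicSeries_of_lt hi) h, zero_mul]
    · rw [h2 m (Finset.mem_filter.mp hm).2 _ (by omega), mul_zero]
  · intro h
    exact absurd (Finset.mem_filter.mpr ⟨Finset.mem_range.mpr (by omega), hn⟩) h

/-- The leading dependence of the defects on the parameters. -/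
theorem coeff_reduction_X_pow_mul_monicSeries_sub {E : Set ℕ} (hDE : D ⊆ E) {l l' : ℕ → ℕ → A}
    {n γ s : ℕ} (hγ : ∀ m ∈ D, m + γ ∈ D) (hnE : n ∈ E) (hn : n + γ ∈ D) (hs : 0 < s)
    (hN : n + γ + s ∉ D)
    (hl : ∀ n ∈ E, ∀ m, m ∉ D → n < m → m < n + s → l n m = l' n m) :
    PowerSeries.coeff (n + γ + s) (reduction D l (PowerSeries.X ^ γ * monicSeries D l n)) -
    PowerSeries.coeff (n + γ + s) (reduction D l' (PowerSeries.X ^ γ * monicSeries D l' n)) =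
      (l n (n + s) - l' n (n + s)) - (l (n + γ) (n + γ + s) - l' (n + γ) (n + γ + s)) := by
  classical
  have hns : n + s ∉ D := fun h => hN (by rw [add_right_comm]; exact hγ _ h)
  have hc : ∀ l : ℕ → ℕ → A, PowerSeries.coeff (n + γ + s)
      (PowerSeries.X ^ γ * monicSeries D l n) = l n (n + s) := by
    intro l
    rw [add_right_comm, PowerSeries.coeff_X_pow_mul,
      coeff_monicSeries_of_notMem hns (by omega)]
  rw [coeff_reduction_of_notMem hN, coeff_reduction_of_notMem hN, hc, hc, sub_sub_sub_comm,
    ← Finset.sum_sub_distrib]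
  congr 1
  -- For `m > n + γ` both factors involve only parameters of degree less than `s`, which agree. The
  -- term `m = n + γ` is the only one with a parameter of degree `s`.
  rw [Finset.sum_eq_single (n + γ)]
  · rw [PowerSeries.coeff_X_pow_mul, PowerSeries.coeff_X_pow_mul, coeff_monicSeries_self,
      coeff_monicSeries_self, one_mul, one_mul]
  · intro m hm hne
    simp only [Finset.mem_filter, Finset.mem_range] at hm
    rcases lt_or_gt_of_ne hne with h | h
    · rw [coeff_X_pow_mul_of_lt (fun i hi => coeff_monicSeries_of_lt hi) h,
        coeff_X_pow_mul_of_lt (fun i hi => coeff_monicSeries_of_lt hi) h, zero_mul, zero_mul,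
        sub_zero]
    · rw [hl m (hDE hm.2) _ hN hm.1 (by omega), ← sub_mul]
      obtain ⟨j, rfl⟩ : ∃ j, m = j + γ := ⟨m - γ, by omega⟩
      rw [PowerSeries.coeff_X_pow_mul, PowerSeries.coeff_X_pow_mul]
      by_cases hj : j ∈ D
      · rw [coeff_monicSeries_of_mem hj (by omega), coeff_monicSeries_of_mem hj (by omega),
          sub_zero, zero_mul]
      · rw [coeff_monicSeries_of_notMem hj (by omega), coeff_monicSeries_of_notMem hj (by omega),
          hl n hnE j hj (by omega) (by omega), sub_self, zero_mul]
  · intro h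
    exact absurd (Finset.mem_filter.mpr ⟨Finset.mem_range.mpr (by omega), hn⟩) h

end Reduction

/-! ### Solving the equations degree by degree -/

/-- The combinatorial data of a flag that enter the equations of its cell: the smallest module `D`
and the largest module `E`, all of whose elements are moved to `D` by `P` and `Q`. -/
structure FlagShape (P Q : ℕ) (D E : Set ℕ) (ρ : ℕ → ℕ) : Prop where
  pos_left : 0 < P
  subset : D ⊆ E
  add_left : ∀ n ∈ E, n + P ∈ D
  add_right : ∀ n ∈ E, n + Q ∈ D
  rank_left : ∀ n, ρ (n + P) = ρ n
  rank_right : ∀ n, n + Q ∉ D → ρ (n + Q) < ρ n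
  finite : Dᶜ.Finite

/-- The equations of the cell, in degrees less than `s`. -/
def SolvesBelow {A : Type u} [CommRing A] (P Q : ℕ) (D E : Set ℕ) (l : ℕ → ℕ → A) (s : ℕ) : Prop :=
  ∀ n ∈ E,
    (∀ N < n + P + s,
      PowerSeries.coeff N (reduction D l (PowerSeries.X ^ P * monicSeries D l n)) = 0) ∧
    (∀ N < n + Q + s,
      PowerSeries.coeff N (reduction D l (PowerSeries.X ^ Q * monicSeries D l n)) = 0)

/-- The equations of the cell. -/
def Solves {A : Type u} [CommRing A] (P Q : ℕ) (D E : Set ℕ) (l : ℕ → ℕ → A) : Prop :=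
  ∀ n ∈ E, reduction D l (PowerSeries.X ^ P * monicSeries D l n) = 0 ∧
    reduction D l (PowerSeries.X ^ Q * monicSeries D l n) = 0

/-- The indices of the coordinates of the cell. -/
def freeIndices (P Q : ℕ) (D E : Set ℕ) : Set (ℕ × ℕ) :=
  {x | IsGen P E x.1 ∧ x.1 < x.2 ∧ x.2 ∉ D ∧ x.2 + Q ∈ D}

section Solve

variable {A : Type u} [CommRing A] {P Q : ℕ} {D E : Set ℕ} {ρ : ℕ → ℕ}

/-- If the degree `s` defects of `l` are the differences of the potential `l - l'`, then passing to
`l'` cancels them and leaves all lower defects unchanged. -/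
theorem SolvesBelow.succ (h : FlagShape P Q D E ρ) {l l' : ℕ → ℕ → A} {s : ℕ} (hs : 0 < s)
    (hl : SolvesBelow P Q D E l s)
    (hll : ∀ n ∈ E, ∀ m, m ∉ D → n < m → m < n + s → l n m = l' n m)
    (hP : ∀ n ∈ E, n + P + s ∉ D → PowerSeries.coeff (n + P + s)
      (reduction D l (PowerSeries.X ^ P * monicSeries D l n)) = (l n (n + s) - l' n (n + s)) -
        (l (n + P) (n + P + s) - l' (n + P) (n + P + s)))
    (hQ : ∀ n ∈ E, n + Q + s ∉ D → PowerSeries.coeff (n + Q + s)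
      (reduction D l (PowerSeries.X ^ Q * monicSeries D l n)) = (l n (n + s) - l' n (n + s)) -
        (l (n + Q) (n + Q + s) - l' (n + Q) (n + Q + s))) :
    SolvesBelow P Q D E l' (s + 1) := by
  have key : ∀ γ, (∀ n ∈ E, n + γ ∈ D) →
      (∀ n ∈ E, ∀ N < n + γ + s,
        PowerSeries.coeff N (reduction D l (PowerSeries.X ^ γ * monicSeries D l n)) = 0) →
      (∀ n ∈ E, n + γ + s ∉ D → PowerSeries.coeff (n + γ + s)
        (reduction D l (PowerSeries.X ^ γ * monicSeries D l n)) = (l n (n + s) - l' n (n + s)) -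
          (l (n + γ) (n + γ + s) - l' (n + γ) (n + γ + s))) →
      ∀ n ∈ E, ∀ N < n + γ + (s + 1),
        PowerSeries.coeff N (reduction D l' (PowerSeries.X ^ γ * monicSeries D l' n)) = 0 := by
    intro γ hγ h0 h1 n hn N hN
    rcases le_or_gt N (n + γ) with hle | hgt
    · exact coeff_reduction_X_pow_mul_monicSeries_of_le (hγ n hn) hle
    obtain ⟨d, rfl⟩ : ∃ d, N = n + γ + d := ⟨N - (n + γ), by omega⟩
    by_cases hND : n + γ + d ∈ D
    · exact coeff_reduction_of_mem hND _
    have hγD : ∀ m ∈ D, m + γ ∈ D := fun m hm => hγ m (h.subset hm)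
    have hsub := coeff_reduction_X_pow_mul_monicSeries_sub h.subset (l := l) (l' := l') hγD hn
      (hγ n hn) (s := d) (by omega) hND
      fun n hn m hm hnm hmd => hll n hn m hm hnm (by omega)
    rcases (show d ≤ s by omega).lt_or_eq with hd | rfl
    · have hnd : n + d ∉ D := fun h => hND (by rw [add_right_comm]; exact hγD _ h)
      rw [h0 n hn _ (by omega), hll n hn _ hnd (by omega) (by omega),
        hll _ (h.subset (hγ n hn)) _ hND (by omega) (by omega)] at hsub
      simpa using hsub
    · rw [h1 n hn hND] at hsub
      simpa using hsub
  exact fun n hn => ⟨key P h.add_left (fun n hn => (hl n hn).1) hP n hn,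
    key Q h.add_right (fun n hn => (hl n hn).2) hQ n hn⟩

theorem exists_solvesBelow (h : FlagShape P Q D E ρ) (c : ℕ → ℕ → A) (s : ℕ) :
    ∃ l : ℕ → ℕ → A, SolvesBelow P Q D E l (s + 1) ∧
      ∀ x ∈ freeIndices P Q D E, x.2 < x.1 + (s + 1) → l x.1 x.2 = c x.1 x.2 := by
  induction s with
  | zero =>
    -- In degree `0` there is nothing to solve: up to its leading exponent, which lies in `D`, each
    -- product reduces to zero.
    refine ⟨c, fun n hn => ⟨fun N hN => ?_, fun N hN => ?_⟩, fun _ _ _ => rfl⟩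
    · exact coeff_reduction_X_pow_mul_monicSeries_of_le (h.add_left n hn) (by omega)
    · exact coeff_reduction_X_pow_mul_monicSeries_of_le (h.add_right n hn) (by omega)
  | succ s ih =>
    obtain ⟨l, hl, hc⟩ := ih
    set u : ℕ → A := fun n => PowerSeries.coeff (n + P + (s + 1))
      (reduction D l (PowerSeries.X ^ P * monicSeries D l n)) with hu
    set v : ℕ → A := fun n => PowerSeries.coeff (n + Q + (s + 1))
      (reduction D l (PowerSeries.X ^ Q * monicSeries D l n)) with hv
    -- The prescribed free value is `l - c`, so that the corrected coordinate `l - μ` equals `c`.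
    -- The cocycle condition compares the two expansions of the reduction of `t ^ P t ^ Q f_n`.
    obtain ⟨μ, h1, h2, h3⟩ := exists_potential (A := A) (X := E) (Y := {n | n + (s + 1) ∉ D})
      h.pos_left (fun n hn => h.subset (h.add_right n hn))
      (fun n hn hn' => hn (by rw [add_right_comm]; exact h.add_left _ (h.subset hn')))
      (fun n => ρ (n + (s + 1))) (fun n => by rw [add_right_comm, h.rank_left])
      (fun n hn => by
        rw [Set.mem_ofPred_eq, add_right_comm] at hn
        rw [add_right_comm]
        exact h.rank_right _ hn) u v (fun n => l n (n + (s + 1)) - c n (n + (s + 1))) (by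
        intro n hn hY
        have e1 := coeff_reduction_X_pow_mul_X_pow_mul (h.add_left n hn) hY (hl n hn).1
          fun m hm => (hl m (h.subset hm)).2
        have e2 := coeff_reduction_X_pow_mul_X_pow_mul (δ := P) (h.add_right n hn)
          (by rw [add_right_comm n]; exact hY) (hl n hn).2 fun m hm => (hl m (h.subset hm)).1
        rw [mul_left_comm, add_right_comm n Q P, e1] at e2
        simp only [hu, hv]
        rw [add_comm, e2, add_comm, add_right_comm n Q P])
    refine ⟨fun n m => if m = n + (s + 1) then l n m - μ n else l n m,
      SolvesBelow.succ h (Nat.succ_pos s) hl ?_ ?_ ?_, ?_⟩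
    · intro n _ m _ _ hm
      rw [if_neg hm.ne]
    · intro n hn hD
      simp only [if_true, sub_sub_cancel]
      rw [h1 n hn hD, add_sub_cancel_left]
    · intro n hn hD
      simp only [if_true, sub_sub_cancel]
      rw [h2 n hn hD, add_sub_cancel_left]
    · rintro ⟨n, m⟩ hx hm
      by_cases hms : m = n + (s + 1)
      · subst hms
        simp only [if_true]
        rw [h3 n hx.1 (by rw [Set.mem_ofPred_eq, not_not, add_right_comm]; exact hx.2.2.2),
          sub_sub_cancel]
      · simp only [if_neg hms]
        exact hc _ hx (by simp only at hm ⊢; omega)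

theorem exists_solves (h : FlagShape P Q D E ρ) (c : ℕ → ℕ → A) :
    ∃ l : ℕ → ℕ → A, Solves P Q D E l ∧
      ∀ x ∈ freeIndices P Q D E, l x.1 x.2 = c x.1 x.2 := by
  obtain ⟨C, hC⟩ := h.finite.bddAbove
  -- All gaps of `D` are at most `C`, so solving in degrees up to `C` solves every equation.
  obtain ⟨l, hl, hc⟩ := exists_solvesBelow h c C
  refine ⟨l, fun n hn => ⟨?_, ?_⟩, fun x hx => hc x hx ?_⟩
  · ext N
    by_cases hN : N ∈ D
    · rw [coeff_reduction_of_mem hN, map_zero]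
    · rw [(hl n hn).1 N (by have := hC hN; omega), map_zero]
  · ext N
    by_cases hN : N ∈ D
    · rw [coeff_reduction_of_mem hN, map_zero]
    · rw [(hl n hn).2 N (by have := hC hN; omega), map_zero]
  · have := hC hx.2.2.1
    omega

/-- In the first degree where two solutions could differ, their difference is a potential with zero
differences that vanishes at the free vertices. -/
theorem Solves.unique (h : FlagShape P Q D E ρ) {l l' : ℕ → ℕ → A} (hl : Solves P Q D E l)
    (hl' : Solves P Q D E l')
    (hll : ∀ x ∈ freeIndices P Q D E, l x.1 x.2 = l' x.1 x.2) :
    ∀ n ∈ E, ∀ m, m ∉ D → n < m → l n m = l' n m := by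
  suffices H : ∀ s, 0 < s → ∀ n ∈ E, n + s ∉ D → l n (n + s) = l' n (n + s) by
    intro n hn m hm hnm
    obtain ⟨s, rfl⟩ : ∃ s, m = n + s := ⟨m - n, by omega⟩
    exact H s (by omega) n hn hm
  intro s
  induction s using Nat.strong_induction_on with
  | _ s ih =>
    intro hs n hn hns
    have hlow : ∀ n ∈ E, ∀ m, m ∉ D → n < m → m < n + s → l n m = l' n m := by
      intro n hn m hm hnm hms
      obtain ⟨d, rfl⟩ : ∃ d, m = n + d := ⟨m - n, by omega⟩
      exact ih d (by omega) (by omega) n hn hm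
    have hD : ∀ m ∈ D, m + P ∈ D := fun m hm => h.add_left m (h.subset hm)
    have hD' : ∀ m ∈ D, m + Q ∈ D := fun m hm => h.add_right m (h.subset hm)
    rw [← sub_eq_zero]
    refine potential_eq_zero (A := A) (X := E) (Y := {n | n + s ∉ D})
      h.pos_left (fun n hn => h.subset (h.add_right n hn))
      (fun n hn hn' => hn (by rw [add_right_comm]; exact hD _ hn'))
      (fun n => ρ (n + s)) (fun n => by rw [add_right_comm, h.rank_left])
      (fun n hn => by
        rw [Set.mem_ofPred_eq, add_right_comm] at hn
        rw [add_right_comm]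
        exact h.rank_right _ hn) (fun n => l n (n + s) - l' n (n + s)) ?_ ?_ ?_ n hn hns
    · intro n hn hY
      have := coeff_reduction_X_pow_mul_monicSeries_sub h.subset (l := l) (l' := l') hD hn
        (h.add_left n hn) hs hY hlow
      rw [(hl n hn).1, (hl' n hn).1, map_zero, sub_zero] at this
      exact (sub_eq_zero.mp this.symm)
    · intro n hn hY
      have := coeff_reduction_X_pow_mul_monicSeries_sub h.subset (l := l) (l' := l') hD' hn
        (h.add_right n hn) hs hY hlow
      rw [(hl n hn).2, (hl' n hn).2, map_zero, sub_zero] at this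
      exact (sub_eq_zero.mp this.symm)
    · intro n hY hn hQ
      rw [Set.mem_ofPred_eq, not_not, add_right_comm] at hQ
      exact sub_eq_zero.mpr (hll (n, n + s) ⟨hn, by simpa using hs, hY, hQ⟩)

end Solve

/-! ### Normalized elements of a flag and its coordinates -/

section Modules

variable {p q r : ℕ}

theorem X_pow_mem_torusRing {A : Type u} [CommRing A] {m : ℕ} (hm : m ∈ semigroup p q r) :
    (PowerSeries.X ^ m : PowerSeries A) ∈ torusRing p q r A := by
  intro n hn
  rw [PowerSeries.coeff_X_pow] at hn
  have : n = m := by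
    by_contra hnm
    exact hn (if_neg hnm)
  rwa [this]

theorem X_pow_mul_mem {A : Type u} [CommRing A] (M : Mod p q r A) {m : ℕ}
    (hm : m ∈ semigroup p q r) {y : PowerSeries A} (hy : y ∈ M) : PowerSeries.X ^ m * y ∈ M :=
  M.smul_mem (⟨PowerSeries.X ^ m, X_pow_mem_torusRing hm⟩ : torusRing p q r A) hy

theorem mul_left_mem_semigroup (n : ℕ) : r * p * n ∈ semigroup p q r := ⟨n, 0, by ring⟩

theorem left_mem_semigroup : r * p ∈ semigroup p q r := ⟨1, 0, by ring⟩

theorem right_mem_semigroup : r * q ∈ semigroup p q r := ⟨0, 1, by ring⟩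

theorem coeff_mul_congr_left {A : Type u} [CommRing A] {N : ℕ} {s s' y : PowerSeries A}
    (h : ∀ j ≤ N, PowerSeries.coeff j s = PowerSeries.coeff j s') :
    PowerSeries.coeff N (s * y) = PowerSeries.coeff N (s' * y) := by
  rw [PowerSeries.coeff_mul, PowerSeries.coeff_mul]
  refine Finset.sum_congr rfl fun x hx => ?_
  rw [h _ (by have := Finset.HasAntidiagonal.mem_antidiagonal.mp hx; omega)]

theorem sum_range_mul_eq {A : Type*} [AddCommMonoid A] (P K : ℕ) (h : ℕ → A) :
    ∑ k ∈ Finset.range (P * K), h k =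
      ∑ i ∈ Finset.range P, ∑ j ∈ Finset.range K, h (i + P * j) := by
  induction K with
  | zero => simp
  | succ K ih =>
    simp only [Finset.sum_range_succ _ K, Finset.sum_add_distrib, ← ih]
    rw [Nat.mul_succ, Finset.sum_range_add]
    simp only [add_comm]

theorem coeff_dilate_mul {A : Type u} [CommRing A] {P : ℕ} (hP : 0 < P) (d : ℕ → A)
    (e : PowerSeries A) (N : ℕ) :
    PowerSeries.coeff N ((PowerSeries.mk fun s => if P ∣ s then d s else 0) * e) =
      ∑ j ∈ Finset.range (N + 1), d (P * j) * PowerSeries.coeff N (PowerSeries.X ^ (P * j) * e) := by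
  rw [coeff_mul_congr_left (s' := ∑ j ∈ Finset.range (N + 1), d (P * j) • PowerSeries.X ^ (P * j)),
    Finset.sum_mul, map_sum]
  · exact Finset.sum_congr rfl fun j _ => by rw [smul_mul_assoc, map_smul, smul_eq_mul]
  · intro s hs
    rw [PowerSeries.coeff_mk, map_sum]
    simp only [map_smul, PowerSeries.coeff_X_pow, smul_eq_mul, mul_ite, mul_one, mul_zero]
    split_ifs with h
    · obtain ⟨t, rfl⟩ := h
      have ht : t ≤ P * t := Nat.le_mul_of_pos_left t hP
      rw [Finset.sum_eq_single t]
      · rw [if_pos rfl]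
      · intro b _ hb
        rw [if_neg fun h => hb (Nat.eq_of_mul_eq_mul_left hP h).symm]
      · intro h
        exact absurd (Finset.mem_range.mpr (by omega)) h
    · symm
      exact Finset.sum_eq_zero fun j _ => if_neg fun h' => h ⟨j, h'⟩

/-- A family of unitriangular systems of linear equations is solvable. -/
theorem exists_triangular_solution {A : Type u} [CommRing A] (b : ℕ → A) (a : ℕ → ℕ → A)
    (ha : ∀ n, a n n = 1) :
    ∃ c : ℕ → A, ∀ N, b N = ∑ k ∈ Finset.range (N + 1), c k * a k N := by
  classical
  let c : ℕ → A := WellFounded.fix (wellFounded_lt (α := ℕ)) fun N rec =>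
    b N - ∑ k : Fin N, rec k k.2 * a k N
  refine ⟨c, fun N => ?_⟩
  have hc : c N = b N - ∑ k : Fin N, c k * a k N := by
    simp only [c]
    rw [WellFounded.fix_eq]
  rw [Finset.sum_range_succ, ha, mul_one, hc, Finset.sum_range fun k => c k * a k N]
  ring

/-- Every `M` contains all series of order at least the bound `C`. No closedness of `M` is assumed:
an infinite combination is regrouped into finitely many ring multiples of elements of `M`. -/
theorem HasValuations.mem_of_forall_lt {A : Type u} [CommRing A] (hp : 0 < p) (hr : 0 < r)
    {M : Mod p q r A} {Δ : Set ℕ} (h : HasValuations M Δ) {C : ℕ} (hC : ∀ n, C ≤ n → n ∈ Δ)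
    {y : PowerSeries A} (hy : ∀ i < C, PowerSeries.coeff i y = 0) : y ∈ M := by
  classical
  set P := r * p with hPdef
  have hP : 0 < P := Nat.mul_pos hr hp
  choose e heM he0 he1 using fun k : ℕ => h.jump (C + k) (hC _ (Nat.le_add_right _ _))
  -- Only the `P` elements `e i`, `i < P`, are used; their translates by powers of `t ^ P` have all
  -- orders `C + k`. Hence the coefficients of each `e i` assemble into one series in `t ^ P`.
  set e' : ℕ → PowerSeries A := fun k => PowerSeries.X ^ (P * (k / P)) * e (k % P) with he'
  have hk : ∀ k, C + k = C + k % P + P * (k / P) := fun k => by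
    have := Nat.mod_add_div k P
    omega
  have he'0 : ∀ k, ∀ i < C + k, PowerSeries.coeff i (e' k) = 0 := fun k i hi =>
    coeff_X_pow_mul_of_lt (he0 (k % P)) (by rwa [← hk])
  have he'1 : ∀ k, PowerSeries.coeff (C + k) (e' k) = 1 := fun k => by
    rw [hk k, he', PowerSeries.coeff_X_pow_mul, he1]
  obtain ⟨c, hc⟩ := exists_triangular_solution (fun N => PowerSeries.coeff (C + N) y)
    (fun k N => PowerSeries.coeff (C + N) (e' k)) he'1
  have hsum : y = ∑ i ∈ Finset.range P,
      (PowerSeries.mk fun s => if P ∣ s then c (i + s) else 0) * e i := by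
    ext n
    rw [map_sum]
    simp only [coeff_dilate_mul hP]
    have h1 : ∀ i ∈ Finset.range P, ∑ j ∈ Finset.range (n + 1), c (i + P * j) *
        PowerSeries.coeff n (PowerSeries.X ^ (P * j) * e i) = ∑ j ∈ Finset.range (n + 1),
        (fun k => c k * PowerSeries.coeff n (e' k)) (i + P * j) := by
      intro i hi
      refine Finset.sum_congr rfl fun j _ => ?_
      have hi := Finset.mem_range.mp hi
      simp only [he']
      rw [Nat.add_mul_mod_self_left, Nat.mod_eq_of_lt hi, Nat.add_mul_div_left _ _ hP,
        Nat.div_eq_of_lt hi, zero_add]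
    rw [Finset.sum_congr rfl h1,
      ← sum_range_mul_eq P (n + 1) fun k => c k * PowerSeries.coeff n (e' k)]
    by_cases hn : n < C
    · rw [hy n hn, Finset.sum_eq_zero]
      intro k _
      rw [he'0 k n (by omega), mul_zero]
    · obtain ⟨N, rfl⟩ : ∃ N, n = C + N := ⟨n - C, by omega⟩
      rw [hc N]
      refine Finset.sum_subset (Finset.range_mono ?_) fun k _ hk => ?_
      · have : C + N + 1 ≤ P * (C + N + 1) := Nat.le_mul_of_pos_left _ hP
        omega
      · rw [he'0 k _ (by simp only [Finset.mem_range] at hk; omega), mul_zero]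
  rw [hsum]
  refine sum_mem fun i _ => ?_
  refine M.smul_mem (⟨PowerSeries.mk fun s => if P ∣ s then c (i + s) else 0, ?_⟩ :
    torusRing p q r A) (heM i)
  intro n hn
  rw [PowerSeries.coeff_mk] at hn
  obtain ⟨t, rfl⟩ : P ∣ n := by
    by_contra h
    exact hn (if_neg h)
  exact mul_left_mem_semigroup t

theorem HasValuations.coeff_eq_zero {A : Type u} [CommRing A] {M : Mod p q r A} {Δ : Set ℕ}
    (h : HasValuations M Δ) {C : ℕ} {y : PowerSeries A} (hy : y ∈ M)
    (h0 : ∀ m ∈ Δ, m < C → PowerSeries.coeff m y = 0) :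
    ∀ i < C, PowerSeries.coeff i y = 0 := by
  intro i
  induction i using Nat.strong_induction_on with
  | _ i ih =>
    intro hi
    by_cases hiΔ : i ∈ Δ
    · exact h0 i hiΔ hi
    · exact h.gap i hiΔ y hy fun j hj => ih j hj (by omega)

/-- The properties of standard flags on which the description of their cells depends. -/
structure AdmissibleFlag (p q r : ℕ) {ℓ : ℕ} (Δ : Fin (ℓ + 1) → Set ℕ) : Prop where
  pos_left : 0 < p
  pos_rank : 0 < r
  mono : Monotone Δ
  birth : ∀ n ∈ Δ (Fin.last ℓ), ∃ β, n ∈ Δ β ∧ (∀ i, n ∈ Δ i → β ≤ i) ∧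
    ∀ m, n < m → m ∈ Δ β → m ∈ Δ 0
  shape : ∃ ρ, FlagShape (r * p) (r * q) (Δ 0) (Δ (Fin.last ℓ)) ρ

section Flag

variable {ℓ : ℕ} {Δ : Fin (ℓ + 1) → Set ℕ} {A : Type u} [CommRing A]

/-- `f` is the normalized element with leading exponent `n` of the smallest member of the flag `x`
that has one. -/
structure IsReduced (x : FlagPoint p q r Δ A) (n : ℕ) (f : PowerSeries A) : Prop where
  mem : ∀ i, n ∈ Δ i → f ∈ x.M i
  coeff_of_lt : ∀ j < n, PowerSeries.coeff j f = 0
  coeff_self : PowerSeries.coeff n f = 1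
  coeff_of_mem : ∀ m ∈ Δ 0, m ≠ n → PowerSeries.coeff m f = 0

/-- Above `n`, `Δ β` has no elements outside `Δ 0`, so the difference has zero coefficients at all
of `Δ β` and must vanish. -/
theorem IsReduced.unique (hΔ : AdmissibleFlag p q r Δ) {x : FlagPoint p q r Δ A} {n : ℕ}
    (hn : n ∈ Δ (Fin.last ℓ)) {f f' : PowerSeries A} (hf : IsReduced x n f)
    (hf' : IsReduced x n f') : f = f' := by
  obtain ⟨β, hβ, -, hβ'⟩ := hΔ.birth n hn
  rw [← sub_eq_zero]
  ext i
  rw [map_zero]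
  refine (x.valuations β).coeff_eq_zero (C := i + 1) (sub_mem (hf.mem β hβ) (hf'.mem β hβ)) ?_ i
    (Nat.lt_succ_self i)
  intro m hm _
  rw [map_sub]
  rcases lt_trichotomy m n with h | rfl | h
  · rw [hf.coeff_of_lt m h, hf'.coeff_of_lt m h, sub_zero]
  · rw [hf.coeff_self, hf'.coeff_self, sub_self]
  · rw [hf.coeff_of_mem m (hβ' m h hm) h.ne', hf'.coeff_of_mem m (hβ' m h hm) h.ne', sub_zero]

theorem AdmissibleFlag.exists_bound (hΔ : AdmissibleFlag p q r Δ) :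
    ∃ C, ∀ n, C ≤ n → n ∈ Δ 0 := by
  obtain ⟨ρ, h⟩ := hΔ.shape
  obtain ⟨C, hC⟩ := h.finite.bddAbove
  refine ⟨C + 1, fun n hn => ?_⟩
  by_contra h
  have := hC h
  omega

theorem exists_isReduced (hΔ : AdmissibleFlag p q r Δ) (x : FlagPoint p q r Δ A) {n : ℕ}
    (hn : n ∈ Δ (Fin.last ℓ)) : ∃ f, IsReduced x n f := by
  classical
  obtain ⟨β, hβ, hβmin, -⟩ := hΔ.birth n hn
  obtain ⟨C, hC⟩ := hΔ.exists_bound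
  have hM : ∀ {y}, y ∈ x.M 0 → y ∈ x.M β := fun hy => x.mono (Fin.zero_le β) hy
  have key : ∀ N, ∃ f ∈ x.M β, (∀ j < n, PowerSeries.coeff j f = 0) ∧
      PowerSeries.coeff n f = 1 ∧ ∀ m ∈ Δ 0, m ≠ n → m < N → PowerSeries.coeff m f = 0 := by
    intro N
    induction N with
    | zero =>
      obtain ⟨e, he, h0, h1⟩ := (x.valuations β).jump n hβ
      exact ⟨e, he, h0, h1, fun m _ _ hm => absurd hm (Nat.not_lt_zero m)⟩
    | succ N ih =>
      obtain ⟨f, hf, h0, h1, h2⟩ := ih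
      by_cases hN : N ∈ Δ 0 ∧ n < N
      · obtain ⟨e, he, he0, he1⟩ := (x.valuations 0).jump N hN.1
        refine ⟨f - PowerSeries.coeff N f • e,
          sub_mem hf (Submodule.smul_of_tower_mem _ _ (hM he)), ?_, ?_, ?_⟩
        · intro j hj
          rw [map_sub, map_smul, h0 j hj, he0 j (by omega), smul_zero, sub_zero]
        · rw [map_sub, map_smul, h1, he0 n hN.2, smul_zero, sub_zero]
        · intro m hm hmn hmN
          rw [map_sub, map_smul]
          rcases (Nat.lt_succ_iff.mp hmN).lt_or_eq with h | rfl
          · rw [h2 m hm hmn h, he0 m h, smul_zero, sub_zero]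
          · rw [he1, smul_eq_mul, mul_one, sub_self]
      · refine ⟨f, hf, h0, h1, fun m hm hmn hmN => ?_⟩
        rcases lt_or_gt_of_ne hmn with h | h
        · exact h0 m h
        · rcases (Nat.lt_succ_iff.mp hmN).lt_or_eq with h' | rfl
          · exact h2 m hm hmn h'
          · exact absurd ⟨hm, h⟩ hN
  obtain ⟨f, hf, h0, h1, h2⟩ := key (max C (n + 1))
  -- Finitely many subtractions clear the exponents of `Δ 0` below the cutoff. The remaining tail
  -- lies in `M 0` and is removed at once; the cutoff exceeds `n`, which protects the leading
  -- coefficient.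
  set w : PowerSeries A := PowerSeries.mk fun j =>
    if j < max C (n + 1) then 0 else PowerSeries.coeff j f with hw
  have hwM : w ∈ x.M 0 := (x.valuations 0).mem_of_forall_lt hΔ.pos_left hΔ.pos_rank hC fun i hi => by
    rw [hw, PowerSeries.coeff_mk, if_pos (lt_max_of_lt_left hi)]
  have hlt : ∀ j < max C (n + 1), PowerSeries.coeff j (f - w) = PowerSeries.coeff j f :=
    fun j hj => by rw [map_sub, hw, PowerSeries.coeff_mk, if_pos hj, sub_zero]
  refine ⟨f - w, fun i hi => x.mono (hβmin i hi) (sub_mem hf (hM hwM)), ?_, ?_, ?_⟩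
  · intro j hj
    rw [hlt j (lt_max_of_lt_right (by omega)), h0 j hj]
  · rw [hlt n (lt_max_of_lt_right (by omega)), h1]
  · intro m hm hmn
    by_cases hmN : m < max C (n + 1)
    · rw [hlt m hmN, h2 m hm hmn hmN]
    · rw [map_sub, hw, PowerSeries.coeff_mk, if_neg hmN, sub_self]

open Classical in
/-- The normalized element of the flag `x` with leading exponent `n`. -/
noncomputable def reducedElement (x : FlagPoint p q r Δ A) (n : ℕ) : PowerSeries A :=
  if h : ∃ f, IsReduced x n f then h.choose else 0

/-- The coordinates of a flag. -/
noncomputable def coordinate (x : FlagPoint p q r Δ A) (n m : ℕ) : A :=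
  PowerSeries.coeff m (reducedElement x n)

theorem isReduced_reducedElement (hΔ : AdmissibleFlag p q r Δ) (x : FlagPoint p q r Δ A) {n : ℕ}
    (hn : n ∈ Δ (Fin.last ℓ)) : IsReduced x n (reducedElement x n) := by
  have h := exists_isReduced hΔ x hn
  rw [reducedElement, dif_pos h]
  exact h.choose_spec

theorem monicSeries_coordinate (hΔ : AdmissibleFlag p q r Δ) (x : FlagPoint p q r Δ A) {n : ℕ}
    (hn : n ∈ Δ (Fin.last ℓ)) : monicSeries (Δ 0) (coordinate x) n = reducedElement x n := by
  have h := isReduced_reducedElement hΔ x hn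
  ext m
  rcases lt_trichotomy m n with hm | rfl | hm
  · rw [coeff_monicSeries_of_lt hm, h.coeff_of_lt m hm]
  · rw [coeff_monicSeries_self, h.coeff_self]
  · by_cases hD : m ∈ Δ 0
    · rw [coeff_monicSeries_of_mem hD hm.ne', h.coeff_of_mem m hD hm.ne']
    · rw [coeff_monicSeries_of_notMem hD hm, coordinate]

theorem monicSeries_congr {D : Set ℕ} {l l' : ℕ → ℕ → A} {n : ℕ}
    (h : ∀ m, m ∉ D → n < m → l n m = l' n m) : monicSeries D l n = monicSeries D l' n := by
  ext m
  rcases lt_trichotomy m n with hm | rfl | hm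
  · rw [coeff_monicSeries_of_lt hm, coeff_monicSeries_of_lt hm]
  · rw [coeff_monicSeries_self, coeff_monicSeries_self]
  · by_cases hD : m ∈ D
    · rw [coeff_monicSeries_of_mem hD hm.ne', coeff_monicSeries_of_mem hD hm.ne']
    · rw [coeff_monicSeries_of_notMem hD hm, coeff_monicSeries_of_notMem hD hm, h m hD hm]

theorem AdmissibleFlag.subset_last (hΔ : AdmissibleFlag p q r Δ) (i : Fin (ℓ + 1)) :
    Δ i ⊆ Δ (Fin.last ℓ) := hΔ.mono (Fin.le_last i)

theorem AdmissibleFlag.zero_subset (hΔ : AdmissibleFlag p q r Δ) (i : Fin (ℓ + 1)) :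
    Δ 0 ⊆ Δ i := hΔ.mono (Fin.zero_le i)

theorem monicSeries_coordinate_mem (hΔ : AdmissibleFlag p q r Δ) (x : FlagPoint p q r Δ A) {n : ℕ}
    {i : Fin (ℓ + 1)} (hn : n ∈ Δ i) : monicSeries (Δ 0) (coordinate x) n ∈ x.M i := by
  rw [monicSeries_coordinate hΔ x (hΔ.subset_last i hn)]
  exact (isReduced_reducedElement hΔ x (hΔ.subset_last i hn)).mem i hn

open Classical in
theorem sum_monicSeries_coordinate_mem (hΔ : AdmissibleFlag p q r Δ) (x : FlagPoint p q r Δ A)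
    (y : PowerSeries A) (C : ℕ) : ∑ m ∈ Finset.range C with m ∈ Δ 0,
      PowerSeries.coeff m y • monicSeries (Δ 0) (coordinate x) m ∈ x.M 0 :=
  sum_mem fun _ hm => Submodule.smul_of_tower_mem _ _
    (monicSeries_coordinate_mem hΔ x (Finset.mem_filter.mp hm).2)

theorem reduction_coordinate_eq_zero (hΔ : AdmissibleFlag p q r Δ) (x : FlagPoint p q r Δ A)
    {y : PowerSeries A} (hy : y ∈ x.M 0) : reduction (Δ 0) (coordinate x) y = 0 := by
  classical
  ext N
  have hcoeff := fun j (hj : j < N + 1) =>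
    coeff_eq_sum_add_reduction (D := Δ 0) (l := coordinate x) hj y
  simp only [map_add, ← sub_eq_iff_eq_add', ← map_sub] at hcoeff
  rw [← hcoeff N (Nat.lt_succ_self N), map_zero]
  refine (x.valuations 0).coeff_eq_zero (C := N + 1)
    (sub_mem hy (sum_monicSeries_coordinate_mem hΔ x y _)) ?_ N (Nat.lt_succ_self N)
  intro m hm hmN
  rw [hcoeff m hmN, coeff_reduction_of_mem hm]

/-- Beyond `n` the exponents of `Δ β` are already in `Δ 0`, so division by the `f_m` with `m ∈ Δ 0`
leaves no remainder. -/
theorem mem_zero_of_coeff_eq_zero (hΔ : AdmissibleFlag p q r Δ) (x : FlagPoint p q r Δ A) {n : ℕ}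
    {β : Fin (ℓ + 1)} (hβ : ∀ m, n < m → m ∈ Δ β → m ∈ Δ 0) {y : PowerSeries A} (hy : y ∈ x.M β)
    (h0 : ∀ j ≤ n, PowerSeries.coeff j y = 0) : y ∈ x.M 0 := by
  classical
  obtain ⟨C, hC⟩ := hΔ.exists_bound
  have hcoeff := fun j (hj : j < C) =>
    coeff_eq_sum_add_reduction (D := Δ 0) (l := coordinate x) hj y
  simp only [map_add, ← sub_eq_iff_eq_add', ← map_sub] at hcoeff
  have hsum := sum_monicSeries_coordinate_mem hΔ x y C
  rw [← sub_add_cancel y (∑ m ∈ Finset.range C with m ∈ Δ 0,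
      PowerSeries.coeff m y • monicSeries (Δ 0) (coordinate x) m)]
  refine add_mem ((x.valuations 0).mem_of_forall_lt hΔ.pos_left hΔ.pos_rank hC ?_) hsum
  refine (x.valuations β).coeff_eq_zero (sub_mem hy (x.mono (Fin.zero_le β) hsum)) ?_
  intro m hm hmC
  rw [hcoeff m hmC]
  rcases le_or_gt m n with h | h
  · exact coeff_reduction_eq_zero fun j hj => h0 j (hj.trans h)
  · exact coeff_reduction_of_mem (hβ m h hm) _

theorem solves_coordinate (hΔ : AdmissibleFlag p q r Δ) (hQ : 0 < r * q)
    (x : FlagPoint p q r Δ A) :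
    Solves (r * p) (r * q) (Δ 0) (Δ (Fin.last ℓ)) (coordinate x) := by
  intro n hn
  obtain ⟨β, hβ, -, hβ'⟩ := hΔ.birth n hn
  have key : ∀ γ ∈ semigroup p q r, 0 < γ → reduction (Δ 0) (coordinate x)
      (PowerSeries.X ^ γ * monicSeries (Δ 0) (coordinate x) n) = 0 := by
    intro γ hγ hpos
    refine reduction_coordinate_eq_zero hΔ x (mem_zero_of_coeff_eq_zero hΔ x hβ'
      (X_pow_mul_mem _ hγ (monicSeries_coordinate_mem hΔ x hβ)) fun j hj => ?_)
    exact coeff_X_pow_mul_of_lt (fun i hi => coeff_monicSeries_of_lt hi) (by omega)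
  exact ⟨key _ left_mem_semigroup (Nat.mul_pos hΔ.pos_rank hΔ.pos_left),
    key _ right_mem_semigroup hQ⟩

/-- Modulo series of large order, `M i` is spanned by the normalized elements with leading exponent
in `Δ i`, and these are given by the coordinates. -/
theorem FlagPoint.M_le_of_coordinate_eq (hΔ : AdmissibleFlag p q r Δ) {x x' : FlagPoint p q r Δ A}
    (h : ∀ n ∈ Δ (Fin.last ℓ), ∀ m, m ∉ Δ 0 → n < m → coordinate x n m = coordinate x' n m)
    (i : Fin (ℓ + 1)) : x.M i ≤ x'.M i := by
  intro y hy
  obtain ⟨C, hC⟩ := hΔ.exists_bound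
  obtain ⟨c, hc, hyc⟩ := exists_combination (x.valuations i) (monicSeries (Δ 0) (coordinate x))
    (fun n hn => monicSeries_coordinate_mem hΔ x hn) (fun n _ j hj => coeff_monicSeries_of_lt hj)
    (fun n _ => coeff_monicSeries_self n) hy C
  have hsum : ∑ n ∈ Finset.range C, c n • monicSeries (Δ 0) (coordinate x) n ∈ x'.M i := by
    refine sum_mem fun n _ => ?_
    by_cases hn : n ∈ Δ i
    · rw [monicSeries_congr (h n (hΔ.subset_last i hn))]
      exact Submodule.smul_of_tower_mem _ _ (monicSeries_coordinate_mem hΔ x' hn)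
    · rw [hc n hn, zero_smul]
      exact zero_mem _
  rw [← sub_add_cancel y (∑ n ∈ Finset.range C, c n • monicSeries (Δ 0) (coordinate x) n)]
  refine add_mem ((x'.valuations i).mem_of_forall_lt hΔ.pos_left hΔ.pos_rank
    (fun n hn => hΔ.zero_subset i (hC n hn)) fun j hj => ?_) hsum
  rw [map_sub, hyc j hj, map_sum]
  simp

end Flag

/-! ### From a solution of the equations back to a flag -/

section Construction

variable {A : Type u} [CommRing A] {D E : Set ℕ} {l : ℕ → ℕ → A}

theorem reduction_monicSeries_of_mem {n : ℕ} (hn : n ∈ D) :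
    reduction D l (monicSeries D l n) = 0 := by
  classical
  ext N
  by_cases hN : N ∈ D
  · rw [coeff_reduction_of_mem hN, map_zero]
  rcases le_or_gt N n with h | h
  · have hlt : N < n := lt_of_le_of_ne h (by rintro rfl; exact hN hn)
    rw [coeff_reduction_eq_zero (fun j hj => coeff_monicSeries_of_lt (by omega)), map_zero]
  · rw [coeff_reduction_of_notMem hN, coeff_monicSeries_of_notMem hN h, Finset.sum_eq_single n,
      coeff_monicSeries_self, one_mul, sub_self, map_zero]
    · intro m hm hmn
      rw [coeff_monicSeries_of_mem (Finset.mem_filter.mp hm).2 hmn, zero_mul]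
    · intro h'
      exact absurd (Finset.mem_filter.mpr ⟨Finset.mem_range.mpr h, hn⟩) h'

theorem reduction_monicSeries_of_notMem {n : ℕ} (hn : n ∉ D) :
    reduction D l (monicSeries D l n) = monicSeries D l n := by
  classical
  have hne : ∀ m ∈ D, m ≠ n := fun m hm h => hn (h ▸ hm)
  ext N
  by_cases hN : N ∈ D
  · rw [coeff_reduction_of_mem hN, coeff_monicSeries_of_mem hN (hne N hN)]
  · rw [coeff_reduction_of_notMem hN, Finset.sum_eq_zero, sub_zero]
    intro m hm
    have hm := (Finset.mem_filter.mp hm).2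
    rw [coeff_monicSeries_of_mem hm (hne m hm), zero_mul]

theorem reduction_mul_eq_zero {s y : PowerSeries A}
    (h : ∀ j, PowerSeries.coeff j s ≠ 0 → reduction D l (PowerSeries.X ^ j * y) = 0) :
    reduction D l (s * y) = 0 := by
  ext N
  rw [coeff_reduction_congr (y' := ∑ j ∈ Finset.range (N + 1),
    PowerSeries.coeff j s • (PowerSeries.X ^ j * y)), map_sum, Finset.sum_eq_zero]
  · intro j _
    rw [map_smul]
    by_cases hj : PowerSeries.coeff j s = 0
    · rw [hj, zero_smul]
    · rw [h j hj, smul_zero]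
  · intro i hi
    simp only [← smul_mul_assoc]
    rw [← Finset.sum_mul]
    refine coeff_mul_congr_left fun j hj => ?_
    rw [map_sum, Finset.sum_eq_single j]
    · simp
    · intro b _ hb
      rw [map_smul, PowerSeries.coeff_X_pow, if_neg hb.symm, smul_zero]
    · intro h
      exact absurd (Finset.mem_range.mpr (by omega)) h

theorem reduction_X_pow_mul_eq_zero {γ : ℕ}
    (h : ∀ n ∈ D, reduction D l (PowerSeries.X ^ γ * monicSeries D l n) = 0) {y : PowerSeries A}
    (hy : reduction D l y = 0) : reduction D l (PowerSeries.X ^ γ * y) = 0 := by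
  classical
  ext N
  rw [coeff_reduction_X_pow_mul, hy, mul_zero, map_zero, map_zero, add_zero, Finset.sum_eq_zero]
  intro m hm
  rw [h m (Finset.mem_filter.mp hm).2, map_zero, mul_zero]

theorem Solves.reduction_X_pow_mul (hDE : D ⊆ E) (hl : Solves (r * p) (r * q) D E l) {γ : ℕ}
    (hγ : γ ∈ semigroup p q r) {y : PowerSeries A} (hy : reduction D l y = 0) :
    reduction D l (PowerSeries.X ^ γ * y) = 0 := by
  obtain ⟨a, b, rfl⟩ := hγ
  induction a with
  | zero =>
    induction b with
    | zero => simpa using hy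
    | succ b ih =>
      rw [show r * (0 * p + (b + 1) * q) = r * q + r * (0 * p + b * q) by ring, pow_add, mul_assoc]
      exact reduction_X_pow_mul_eq_zero (fun n hn => (hl n (hDE hn)).2) ih
  | succ a ih =>
    rw [show r * ((a + 1) * p + b * q) = r * p + r * (a * p + b * q) by ring, pow_add, mul_assoc]
    exact reduction_X_pow_mul_eq_zero (fun n hn => (hl n (hDE hn)).1) ih

theorem Solves.reduction_X_pow_mul_monicSeries (hDE : D ⊆ E)
    (hl : Solves (r * p) (r * q) D E l) {γ : ℕ} (hγ : γ ∈ semigroup p q r) (hγ0 : γ ≠ 0) {n : ℕ}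
    (hn : n ∈ E) : reduction D l (PowerSeries.X ^ γ * monicSeries D l n) = 0 := by
  obtain ⟨a, b, rfl⟩ := hγ
  rcases a with _ | a
  · rcases b with _ | b
    · simp at hγ0
    · rw [show r * (0 * p + (b + 1) * q) = r * (0 * p + b * q) + r * q by ring, pow_add, mul_assoc]
      exact hl.reduction_X_pow_mul hDE ⟨0, b, rfl⟩ (hl n hn).2
  · rw [show r * ((a + 1) * p + b * q) = r * (a * p + b * q) + r * p by ring, pow_add, mul_assoc]
    exact hl.reduction_X_pow_mul hDE ⟨a, b, rfl⟩ (hl n hn).1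

theorem Solves.reduction_mul (hDE : D ⊆ E) (hl : Solves (r * p) (r * q) D E l)
    {s : PowerSeries A} (hs : s ∈ torusRing p q r A) {y : PowerSeries A}
    (hy : reduction D l y = 0) : reduction D l (s * y) = 0 :=
  reduction_mul_eq_zero fun j hj => hl.reduction_X_pow_mul hDE (hs j hj) hy

/-- Modulo the smallest module, the ring acts on `f_n` through the constant term, because every
nonzero exponent of the semigroup sends `f_n` into the kernel of the reduction. -/
theorem Solves.reduction_mul_monicSeries (hDE : D ⊆ E) (hl : Solves (r * p) (r * q) D E l)
    {s : PowerSeries A} (hs : s ∈ torusRing p q r A) {n : ℕ} (hn : n ∈ E) (hnD : n ∉ D) :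
    reduction D l (s * monicSeries D l n) = PowerSeries.coeff 0 s • monicSeries D l n := by
  have h : reduction D l ((s - PowerSeries.C (PowerSeries.coeff 0 s)) * monicSeries D l n) = 0 := by
    refine reduction_mul_eq_zero fun j hj => ?_
    have hj0 : j ≠ 0 := by
      rintro rfl
      simp at hj
    rw [map_sub, PowerSeries.coeff_C, if_neg hj0, sub_zero] at hj
    exact hl.reduction_X_pow_mul_monicSeries hDE (hs j hj) hj0 hn
  rw [sub_mul, map_sub, sub_eq_zero, ← PowerSeries.smul_eq_C_mul, map_smul,
    reduction_monicSeries_of_notMem hnD] at h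
  exact h

/-- The module with set of valuations `Δ`, `D ⊆ Δ ⊆ E`, given by a solution of the equations. -/
noncomputable def Solves.toMod (hDE : D ⊆ E) (hD : Dᶜ.Finite) (hl : Solves (r * p) (r * q) D E l)
    {Δ : Set ℕ} (hΔ : Δ ⊆ E) : Mod p q r A where
  -- The kernel of the reduction plays the role of `M 0`; to it are added the `f_k` with `k ∈ Δ`
  -- outside `D`. The sum runs over the finite complement of `D`, and `c` vanishes off `Δ`.
  carrier := {y | ∃ c : ℕ → A, (∀ k, k ∉ Δ → c k = 0) ∧
    reduction D l y = ∑ k ∈ hD.toFinset, c k • monicSeries D l k}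
  zero_mem' := ⟨0, by simp, by simp⟩
  add_mem' := by
    rintro x y ⟨c, hc, hx⟩ ⟨d, hd, hy⟩
    refine ⟨c + d, fun k hk => by simp [hc k hk, hd k hk], ?_⟩
    rw [map_add, hx, hy, ← Finset.sum_add_distrib]
    simp only [Pi.add_apply, add_smul]
  smul_mem' := by
    rintro ⟨s, hs⟩ y ⟨c, hc, hy⟩
    refine ⟨fun k => PowerSeries.coeff 0 s * c k, fun k hk => by simp [hc k hk], ?_⟩
    have hmem : ∀ k ∈ hD.toFinset, k ∉ D := fun k hk => by simpa using hk
    have h0 : reduction D l (y - ∑ k ∈ hD.toFinset, c k • monicSeries D l k) = 0 := by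
      rw [map_sub, map_sum, hy, sub_eq_zero]
      refine Finset.sum_congr rfl fun k hk => ?_
      rw [map_smul, reduction_monicSeries_of_notMem (hmem k hk)]
    have h1 := hl.reduction_mul hDE hs h0
    rw [mul_sub, map_sub, sub_eq_zero, Finset.mul_sum, map_sum] at h1
    change reduction D l (s * y) = _
    rw [h1]
    refine Finset.sum_congr rfl fun k hk => ?_
    rw [mul_smul_comm, map_smul]
    by_cases hkΔ : k ∈ Δ
    · rw [hl.reduction_mul_monicSeries hDE hs (hΔ hkΔ) (hmem k hk), smul_smul, mul_comm]
    · simp only [hc k hkΔ, zero_smul, mul_zero]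

theorem Solves.monicSeries_mem_toMod (hDE : D ⊆ E) (hD : Dᶜ.Finite)
    (hl : Solves (r * p) (r * q) D E l) {Δ : Set ℕ} (hΔ : Δ ⊆ E) {n : ℕ} (hn : n ∈ Δ) :
    monicSeries D l n ∈ hl.toMod hDE hD hΔ := by
  classical
  by_cases hnD : n ∈ D
  · exact ⟨0, by simp, by simpa using reduction_monicSeries_of_mem hnD⟩
  · refine ⟨Pi.single n 1, fun k hk => ?_, ?_⟩
    · rw [Pi.single_eq_of_ne (by rintro rfl; exact hk hn)]
    · rw [reduction_monicSeries_of_notMem hnD, Finset.sum_eq_single n]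
      · simp
      · intro b _ hb
        rw [Pi.single_eq_of_ne hb, zero_smul]
      · intro h
        exact absurd (by simpa using hnD) h

theorem Solves.hasValuations_toMod (hDE : D ⊆ E) (hD : Dᶜ.Finite)
    (hl : Solves (r * p) (r * q) D E l) {Δ : Set ℕ} (hΔ : Δ ⊆ E) (hDΔ : D ⊆ Δ) :
    HasValuations (hl.toMod hDE hD hΔ) Δ := by
  refine ⟨fun n hn => ⟨_, hl.monicSeries_mem_toMod hDE hD hΔ hn,
    fun i hi => coeff_monicSeries_of_lt hi, coeff_monicSeries_self n⟩, ?_⟩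
  rintro n hn y ⟨c, hc, hy⟩ h0
  have hnD : n ∉ D := fun h => hn (hDΔ h)
  have hcoeff : ∀ k, k ∉ D → (∀ j < k, j ∉ D → c j = 0) →
      PowerSeries.coeff k (reduction D l y) = c k := by
    intro k hk hlt
    rw [hy, map_sum, Finset.sum_eq_single k]
    · rw [map_smul, coeff_monicSeries_self, smul_eq_mul, mul_one]
    · intro j hj hjk
      rw [map_smul]
      rcases lt_or_gt_of_ne hjk with h | h
      · rw [hlt j h (by simpa using hj), zero_smul]
      · rw [coeff_monicSeries_of_lt h, smul_zero]
    · intro h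
      exact absurd (by simpa using hk) h
  -- The remainder of `y` also vanishes below `n`, and the `f_k` are unitriangular, so the
  -- coefficients `c k` vanish one after the other.
  have hzero : ∀ k < n, k ∉ D → c k = 0 := by
    intro k
    induction k using Nat.strong_induction_on with
    | _ k ih =>
      intro hk hkD
      rw [← hcoeff k hkD fun j hj hjD => ih j hj (by omega) hjD]
      exact coeff_reduction_eq_zero fun j hj => h0 j (by omega)
  rw [← coeff_reduction_of_forall_lt h0 hnD, hcoeff n hnD hzero, hc n hn]

end Construction

section Flag

variable {ℓ : ℕ} {Δ : Fin (ℓ + 1) → Set ℕ} {A : Type u} [CommRing A]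

/-- The flag given by a solution of the equations. -/
noncomputable def Solves.toFlagPoint (hΔ : AdmissibleFlag p q r Δ) (hD : (Δ 0)ᶜ.Finite)
    {l : ℕ → ℕ → A} (hl : Solves (r * p) (r * q) (Δ 0) (Δ (Fin.last ℓ)) l) :
    FlagPoint p q r Δ A where
  M i := hl.toMod (hΔ.zero_subset _) hD (hΔ.subset_last i)
  mono _ _ hij := fun _ ⟨c, hc, hy⟩ => ⟨c, fun k hk => hc k fun h => hk (hΔ.mono hij h), hy⟩
  valuations i := hl.hasValuations_toMod _ hD (hΔ.subset_last i) (hΔ.zero_subset i)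

theorem Solves.coordinate_toFlagPoint (hΔ : AdmissibleFlag p q r Δ) (hD : (Δ 0)ᶜ.Finite)
    {l : ℕ → ℕ → A} (hl : Solves (r * p) (r * q) (Δ 0) (Δ (Fin.last ℓ)) l) {n m : ℕ}
    (hn : n ∈ Δ (Fin.last ℓ)) (hm : m ∉ Δ 0) (hnm : n < m) :
    coordinate (hl.toFlagPoint hΔ hD) n m = l n m := by
  have h : IsReduced (hl.toFlagPoint hΔ hD) n (monicSeries (Δ 0) l n) :=
    ⟨fun i hi => hl.monicSeries_mem_toMod (hΔ.zero_subset _) hD (hΔ.subset_last i) hi,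
      fun j hj => coeff_monicSeries_of_lt hj, coeff_monicSeries_self n,
      fun m hm hmn => coeff_monicSeries_of_mem hm hmn⟩
  rw [coordinate, (isReduced_reducedElement hΔ _ hn).unique hΔ hn h,
    coeff_monicSeries_of_notMem hm hnm]

/-- The free coordinates of a flag. -/
noncomputable def freeCoordinates (x : FlagPoint p q r Δ A) :
    freeIndices (r * p) (r * q) (Δ 0) (Δ (Fin.last ℓ)) → A :=
  fun a => coordinate x a.1.1 a.1.2

theorem bijective_freeCoordinates (hΔ : AdmissibleFlag p q r Δ) (hQ : 0 < r * q) :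
    Function.Bijective (freeCoordinates (p := p) (q := q) (r := r) (Δ := Δ) (A := A)) := by
  classical
  obtain ⟨ρ, hS⟩ := hΔ.shape
  constructor
  · intro x x' h
    have heq := (solves_coordinate hΔ hQ x).unique hS (solves_coordinate hΔ hQ x')
      fun a ha => congrFun h ⟨a, ha⟩
    refine FlagPoint.ext (funext fun i => le_antisymm (FlagPoint.M_le_of_coordinate_eq hΔ heq i)
      (FlagPoint.M_le_of_coordinate_eq hΔ (fun n hn m hm hnm => (heq n hn m hm hnm).symm) i))
  · intro c
    obtain ⟨l, hl, hlc⟩ := exists_solves hS fun n m =>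
      if h : (n, m) ∈ freeIndices (r * p) (r * q) (Δ 0) (Δ (Fin.last ℓ)) then c ⟨(n, m), h⟩ else 0
    refine ⟨hl.toFlagPoint hΔ hS.finite, funext fun ⟨⟨n, m⟩, ha⟩ => ?_⟩
    refine (hl.coordinate_toFlagPoint hΔ hS.finite ha.1.1 ha.2.2.1 ha.2.1).trans ?_
    rw [hlc _ ha, dif_pos ha]

/-- The image of a normalized element is normalized for the base-changed flag, so uniqueness makes
the coordinates natural. -/
theorem freeCoordinates_map (hΔ : AdmissibleFlag p q r Δ) {B : Type u} [CommRing B] (f : A →+* B)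
    (x : FlagPoint p q r Δ A) : freeCoordinates (x.map f) = f ∘ freeCoordinates x := by
  funext ⟨⟨n, m⟩, ha⟩
  have hn : n ∈ Δ (Fin.last ℓ) := ha.1.1
  have h := isReduced_reducedElement hΔ x hn
  have h' : IsReduced (x.map f) n (PowerSeries.map f (reducedElement x n)) :=
    ⟨fun i hi => Submodule.subset_span ⟨_, h.mem i hi, rfl⟩,
      fun j hj => by rw [PowerSeries.coeff_map, h.coeff_of_lt j hj, map_zero],
      by rw [PowerSeries.coeff_map, h.coeff_self, map_one],
      fun m hm hmn => by rw [PowerSeries.coeff_map, h.coeff_of_mem m hm hmn, map_zero]⟩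
  change PowerSeries.coeff m _ = f (PowerSeries.coeff m _)
  rw [(isReduced_reducedElement hΔ _ hn).unique hΔ hn h', PowerSeries.coeff_map]

end Flag

end Modules

/-! ### Representability by a polynomial ring and dimension -/

section AffineSpace

variable {p q r : ℕ} {k : Type u} [Field k]

/-- Algebra homomorphisms from a polynomial ring are families of elements. -/
noncomputable def mvPolynomialHomEquiv (N : ℕ) (A : CommAlgCat.{u} k) :
    (CommAlgCat.of k (MvPolynomial (Fin N) k) ⟶ A) ≃ (Fin N → A) where
  toFun f i := f.hom (MvPolynomial.X i)
  invFun v := CommAlgCat.ofHom (MvPolynomial.aeval v)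
  left_inv f := by
    apply CommAlgCat.hom_ext
    apply MvPolynomial.algHom_ext
    intro i
    simp
  right_inv v := by
    funext i
    simp

theorem isAffineSpace_flagCell {ℓ : ℕ} {Δ : Fin (ℓ + 1) → Set ℕ} (hΔ : AdmissibleFlag p q r Δ)
    (hQ : 0 < r * q) {N : ℕ}
    (e : Fin N ≃ freeIndices (r * p) (r * q) (Δ 0) (Δ (Fin.last ℓ))) :
    IsAffineSpace (flagCell k p q r Δ) N := by
  let coord (A : CommAlgCat.{u} k) : (flagCell k p q r Δ).obj A ≃ (Fin N → A) :=
    (Equiv.ofBijective (freeCoordinates (A := A)) (bijective_freeCoordinates hΔ hQ)).trans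
      (e.arrowCongr (Equiv.refl A)).symm
  have hcoord : ∀ {A B : CommAlgCat.{u} k} (f : A ⟶ B) (x : (flagCell k p q r Δ).obj A) (i : Fin N),
      coord B ((flagCell k p q r Δ).map f x) i = f.hom (coord A x i) := fun f x i =>
    congrFun (freeCoordinates_map hΔ f.hom.toRingHom x) (e i)
  refine ⟨⟨fun {A} => (mvPolynomialHomEquiv N A).trans (coord A).symm, ?_⟩⟩
  intro A B f φ
  apply (coord B).injective
  funext i
  rw [hcoord, Equiv.trans_apply, Equiv.trans_apply, Equiv.apply_symm_apply,
    Equiv.apply_symm_apply]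
  rfl

theorem IsAffineSpace.dim_eq {X : CommAlgCat.{u} k ⥤ Type u} {N : ℕ} (h : IsAffineSpace X N) :
    dim X = N := by
  obtain ⟨e⟩ := h
  have hX : X.IsCorepresentable := e.isCorepresentable
  rw [dim, dif_pos hX, ringKrullDim_eq_of_ringEquiv
    (CommAlgCat.algEquivOfIso e.isoCoreprX).symm.toRingEquiv]
  refine MvPolynomial.ringKrullDim_of_isNoetherianRing.trans ?_
  rw [ringKrullDim_eq_zero_of_field, zero_add, Nat.card_fin]

theorem IsAffineSpace.dimInt_eq {X : CommAlgCat.{u} k ⥤ Type u} {N : ℕ} (h : IsAffineSpace X N) :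
    dimInt X = N := by
  rw [dimInt, h.dim_eq]
  rfl

end AffineSpace

/-! ### Combinatorics of standard modules and counting of free indices -/

section Combinatorics

variable {p q r : ℕ}

/-- The number of translations by `r * q` after which `N` is congruent to one of `0, …, r - 1`
modulo `r * p`. -/
noncomputable def gapRank (p q r N : ℕ) : ℕ := sInf {k | (N + k * (r * q)) % (r * p) < r}

theorem exists_mod_lt (hp : 0 < p) (hcop : Nat.Coprime p q) (hr : 0 < r) (N : ℕ) :
    ∃ k, (N + k * (r * q)) % (r * p) < r := by
  have hle : p * q + N / r ≤ p * (q + N / r) := by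
    rw [mul_add]
    exact Nat.add_le_add_left (Nat.le_mul_of_pos_left _ hp) _
  -- The number `p * (q + N / r) - N / r` is congruent to `-(N / r)` modulo `p` and is at least `p *
  -- q`, hence has the form `a * p + b * q`; this `b` is the required number of translations.
  obtain ⟨a, b, hab⟩ := Nat.exists_add_mul_eq_of_gcd_dvd_of_mul_pred_le p q
    (p * (q + N / r) - N / r) (by rw [hcop.gcd_eq_one]; exact one_dvd _)
    ((Nat.mul_le_mul (Nat.pred_le p) (Nat.pred_le q)).trans (by omega))
  obtain ⟨u, hu⟩ : p ∣ N / r + b * q := by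
    rw [← Nat.dvd_add_right (Dvd.intro_left a rfl : p ∣ a * p)]
    exact ⟨q + N / r, by omega⟩
  refine ⟨b, ?_⟩
  have h : N + b * (r * q) = N % r + r * p * u := by
    rw [mul_assoc, ← hu]
    conv_lhs => rw [← Nat.mod_add_div N r]
    ring
  rw [h, Nat.add_mul_mod_self_left]
  exact (Nat.mod_le _ _).trans_lt (Nat.mod_lt _ hr)

theorem IsModule.add_mem {Δ : Set ℕ} (h : IsModule p q r Δ) {γ n : ℕ} (hγ : γ ∈ semigroup p q r)
    (hn : n ∈ Δ) : n + γ ∈ Δ := by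
  rw [add_comm]
  exact h γ hγ n hn

theorem IsStandard.mem_of_mod_lt {Δ : Set ℕ} (h : IsStandard p q r Δ) {N : ℕ}
    (hN : N % (r * p) < r) : N ∈ Δ := by
  rw [← Nat.mod_add_div N (r * p)]
  exact h.isModule.add_mem (mul_left_mem_semigroup _) (h.standard _ hN)

theorem IsStandard.finite_compl {Δ : Set ℕ} (h : IsStandard p q r Δ) (hcop : Nat.Coprime p q)
    (hr : 0 < r) : Δᶜ.Finite := by
  refine (Set.finite_lt_nat (r * (p * q))).subset fun N hN => ?_
  by_contra hle
  have hle : p * q ≤ N / r := (Nat.le_div_iff_mul_le hr).mpr (by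
    rw [mul_comm]
    exact not_lt.mp hle)
  obtain ⟨a, b, hab⟩ := Nat.exists_add_mul_eq_of_gcd_dvd_of_mul_pred_le p q (N / r)
    (by rw [hcop.gcd_eq_one]; exact one_dvd _)
    ((Nat.mul_le_mul (Nat.pred_le p) (Nat.pred_le q)).trans hle)
  refine hN ?_
  rw [← Nat.mod_add_div N r]
  exact h.isModule.add_mem ⟨a, b, by rw [hab]⟩ (h.standard _ (Nat.mod_lt _ hr))

theorem gapRank_add_left (N : ℕ) : gapRank p q r (N + r * p) = gapRank p q r N := by
  unfold gapRank
  congr 1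
  ext k
  simp only [Set.mem_ofPred_eq]
  rw [add_right_comm, Nat.add_mod_right]

/-- Rank `0` forces `N`, and then `N + r * q`, into `Δ`; for positive rank one translation has been
used up. -/
theorem IsStandard.gapRank_add_right {Δ : Set ℕ} (h : IsStandard p q r Δ) (hp : 0 < p)
    (hcop : Nat.Coprime p q) (hr : 0 < r) {N : ℕ} (hN : N + r * q ∉ Δ) :
    gapRank p q r (N + r * q) < gapRank p q r N := by
  have hmem : gapRank p q r N ∈ {k | (N + k * (r * q)) % (r * p) < r} :=
    Nat.sInf_mem (exists_mod_lt hp hcop hr N)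
  rcases hk : gapRank p q r N with _ | k
  · rw [hk] at hmem
    exact absurd (h.isModule.add_mem right_mem_semigroup
      (h.mem_of_mod_lt (by simpa using hmem))) hN
  · rw [hk] at hmem
    refine Nat.lt_succ_of_le (Nat.sInf_le ?_)
    rw [Set.mem_ofPred_eq] at hmem ⊢
    rwa [show N + r * q + k * (r * q) = N + (k + 1) * (r * q) by ring]

theorem IsStandardFlag.mem_cases {ℓ : ℕ} {Δ : Fin (ℓ + 1) → Set ℕ} {g : Fin ℓ → ℕ}
    (h : IsStandardFlag p q r Δ g) (i : Fin (ℓ + 1)) :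
    ∀ m ∈ Δ i, m ∈ Δ 0 ∨ ∃ j : Fin ℓ, j.castSucc < i ∧ m = g j := by
  induction i using Fin.induction with
  | zero => exact fun m hm => Or.inl hm
  | succ i ih =>
    intro m hm
    rw [h.step] at hm
    rcases hm with hm | hm
    · rcases ih m hm with h0 | ⟨j, hj, hmj⟩
      · exact Or.inl h0
      · exact Or.inr ⟨j, hj.trans (Fin.castSucc_lt_succ), hmj⟩
    · exact Or.inr ⟨i, Fin.castSucc_lt_succ, hm⟩

theorem IsStandardFlag.monotone {ℓ : ℕ} {Δ : Fin (ℓ + 1) → Set ℕ} {g : Fin ℓ → ℕ}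
    (h : IsStandardFlag p q r Δ g) : Monotone Δ :=
  Fin.monotone_iff_le_succ.mpr fun i => by
    rw [h.step]
    exact Set.subset_union_left

theorem IsStandardFlag.mem_zero {ℓ : ℕ} {Δ : Fin (ℓ + 1) → Set ℕ} {g : Fin ℓ → ℕ}
    (h : IsStandardFlag p q r Δ g) {i : Fin ℓ} {m : ℕ} (hm : m ∈ Δ i.succ) (hgm : g i < m) :
    m ∈ Δ 0 := by
  rcases h.mem_cases _ m hm with h0 | ⟨j, hj, rfl⟩
  · exact h0
  · have := h.strictMono.monotone (Fin.castSucc_lt_succ_iff.mp hj)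
    omega

theorem IsStandardFlag.admissible {ℓ : ℕ} {Δ : Fin (ℓ + 1) → Set ℕ} {g : Fin ℓ → ℕ}
    (h : IsStandardFlag p q r Δ g) (hp : 0 < p) (hq : 0 < q) (hcop : Nat.Coprime p q)
    (hr : 0 < r) : AdmissibleFlag p q r Δ := by
  have hbirth : ∀ n ∈ Δ (Fin.last ℓ), ∃ β, n ∈ Δ β ∧ (∀ i, n ∈ Δ i → β ≤ i) ∧
      ∀ m, n < m → m ∈ Δ β → m ∈ Δ 0 := by
    intro n hn
    -- If the first stage `β` containing `n` is a successor, then `n` is the element added there,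
    -- and elements added earlier are smaller than `n`.
    obtain ⟨β, hβ, hmin⟩ := (wellFounded_lt (α := Fin (ℓ + 1))).has_min {i | n ∈ Δ i} ⟨_, hn⟩
    refine ⟨β, hβ, fun i hi => not_lt.mp (hmin i hi), fun m hnm hm => ?_⟩
    induction β using Fin.cases with
    | zero => exact hm
    | succ j =>
      refine h.mem_zero hm ?_
      have hβ' : n ∈ Δ j.castSucc ∪ {g j} := by rwa [← h.step]
      rcases hβ' with h' | h'
      · exact absurd Fin.castSucc_lt_succ (hmin _ h')
      · rwa [← Set.mem_singleton_iff.mp h']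
  have hadd : ∀ γ ∈ semigroup p q r, 0 < γ → ∀ n ∈ Δ (Fin.last ℓ), n + γ ∈ Δ 0 := by
    intro γ hγ hpos n hn
    obtain ⟨β, hβ, -, hβ'⟩ := hbirth n hn
    exact hβ' _ (by omega) ((h.isStandard β).isModule.add_mem hγ hβ)
  exact ⟨hp, hr, h.monotone, hbirth, gapRank p q r, Nat.mul_pos hr hp, h.monotone (Fin.zero_le _),
    hadd _ left_mem_semigroup (Nat.mul_pos hr hp), hadd _ right_mem_semigroup (Nat.mul_pos hr hq),
    gapRank_add_left, fun n hn => (h.isStandard 0).gapRank_add_right hp hcop hr hn,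
    (h.isStandard 0).finite_compl hcop hr⟩

theorem finite_freeIndices {P Q : ℕ} {D E : Set ℕ} (hD : Dᶜ.Finite) :
    (freeIndices P Q D E).Finite := by
  obtain ⟨C, hC⟩ := hD.bddAbove
  refine ((Set.finite_lt_nat C).prod hD).subset fun x hx => ⟨?_, hx.2.2.1⟩
  exact lt_of_lt_of_le hx.2.1 (hC hx.2.2.1)

/-- Translation by `Q` matches the gaps above `n + Q` with those `m > n` for which `m + Q` is a gap;
such an `m` is itself a gap, since `D` is stable under `Q`. -/
theorem ncard_free_add_ncard_gaps {Q : ℕ} {D : Set ℕ} (hD : Dᶜ.Finite) (hDQ : ∀ n ∈ D, n + Q ∈ D)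
    (n : ℕ) : {m | n < m ∧ m ∉ D ∧ m + Q ∈ D}.ncard + {m | n + Q < m ∧ m ∉ D}.ncard =
      {m | n < m ∧ m ∉ D}.ncard := by
  have himage : {m | n + Q < m ∧ m ∉ D} = (fun m => m + Q) '' {m | n < m ∧ m + Q ∉ D} := by
    ext m
    constructor
    · rintro ⟨h1, h2⟩
      have hm : m - Q + Q = m := by omega
      exact ⟨m - Q, ⟨by omega, by rwa [hm]⟩, hm⟩
    · rintro ⟨m, ⟨h1, h2⟩, rfl⟩
      exact ⟨Nat.add_lt_add_right h1 Q, h2⟩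
  rw [himage, Set.ncard_image_of_injective _ (add_left_injective Q),
    ← Set.ncard_union_eq ?_ (hD.subset fun m hm => hm.2.1)
      (hD.subset fun m hm h => hm.2 (hDQ m h))]
  · congr 1
    ext m
    constructor
    · rintro (⟨h1, h2, -⟩ | ⟨h1, h2⟩)
      · exact ⟨h1, h2⟩
      · exact ⟨h1, fun h => h2 (hDQ m h)⟩
    · rintro ⟨h1, h2⟩
      by_cases h : m + Q ∈ D
      · exact Or.inl ⟨h1, h2, h⟩
      · exact Or.inr ⟨h1, h⟩
  · rw [Set.disjoint_left]
    exact fun m h1 h2 => h2.2 h1.2.2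

/-- The `P`-generators of `E ∪ {g}` are those of `E` with `g + P` replaced by `g`. -/
theorem ncard_freeIndices_union {P Q g : ℕ} {D E : Set ℕ} (hP : 0 < P) (hD : Dᶜ.Finite)
    (hEP : ∀ n ∈ E, n + P ∈ E) (hgE : g + P ∈ E) (hg : g ∉ E) :
    (freeIndices P Q D (E ∪ {g})).ncard + {m | g + P < m ∧ m ∉ D ∧ m + Q ∈ D}.ncard =
      (freeIndices P Q D E).ncard + {m | g < m ∧ m ∉ D ∧ m + Q ∈ D}.ncard := by
  have hcard : ∀ n : ℕ, {m | n < m ∧ m ∉ D ∧ m + Q ∈ D}.ncard =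
      (({n} : Set ℕ) ×ˢ {m | n < m ∧ m ∉ D ∧ m + Q ∈ D}).ncard := fun n => by
    rw [Set.ncard_prod, Set.ncard_singleton, one_mul]
  have hfin : ∀ n : ℕ, (({n} : Set ℕ) ×ˢ {m | n < m ∧ m ∉ D ∧ m + Q ∈ D}).Finite := fun n =>
    (Set.finite_singleton n).prod (hD.subset fun m hm => hm.2.1)
  have hgen : ∀ n, IsGen P (E ∪ {g}) n ∨ n = g + P ↔ IsGen P E n ∨ n = g := by
    intro n
    constructor
    · rintro (⟨h1 | h1, h2⟩ | rfl)
      · exact Or.inl ⟨h1, fun m hm => h2 m (Or.inl hm)⟩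
      · exact Or.inr h1
      · exact Or.inl ⟨hgE, fun m hm h => hg (by rwa [← Nat.add_right_cancel h])⟩
    · rintro (⟨h1, h2⟩ | rfl)
      · by_cases h : n = g + P
        · exact Or.inr h
        · refine Or.inl ⟨Or.inl h1, ?_⟩
          rintro m (hm | rfl)
          · exact h2 m hm
          · exact fun h' => h h'.symm
      · refine Or.inl ⟨Or.inr rfl, ?_⟩
        rintro m (hm | rfl) h
        · exact hg (h ▸ hEP m hm)
        · omega
  rw [hcard, hcard, ← Set.ncard_union_eq _ (finite_freeIndices hD) (hfin _),
    ← Set.ncard_union_eq _ (finite_freeIndices hD) (hfin _)]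
  · congr 1
    ext ⟨n, m⟩
    have := hgen n
    simp only [freeIndices, Set.mem_union, Set.mem_ofPred_eq, Set.mem_prod, Set.mem_singleton_iff]
    constructor
    · rintro (⟨h1, h2⟩ | ⟨rfl, h2⟩)
      · rcases this.mp (Or.inl h1) with h | rfl
        · exact Or.inl ⟨h, h2⟩
        · exact Or.inr ⟨rfl, h2⟩
      · rcases this.mp (Or.inr rfl) with h | h
        · exact Or.inl ⟨h, h2⟩
        · omega
    · rintro (⟨h1, h2⟩ | ⟨rfl, h2⟩)
      · rcases this.mpr (Or.inl h1) with h | rfl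
        · exact Or.inl ⟨h, h2⟩
        · exact Or.inr ⟨rfl, h2⟩
      · rcases this.mpr (Or.inr rfl) with h | h
        · exact Or.inl ⟨h, h2⟩
        · omega
  · rw [Set.disjoint_left]
    rintro ⟨n, m⟩ h1 ⟨rfl, -⟩
    exact hg h1.1.1
  · rw [Set.disjoint_left]
    rintro ⟨n, m⟩ h1 ⟨h2, -⟩
    exact h1.1.2 g (Or.inr rfl) (Set.mem_singleton_iff.mp h2).symm

/-- Since `b ∈ Δ`, counting from `b` or strictly above `b` is the same; this allows `D` to replace
`Δ`. -/
theorem gaps_eq_ncard {D Δ : Set ℕ} {b : ℕ} (hb : b ∈ Δ) (h : ∀ m, b < m → (m ∈ Δ ↔ m ∈ D)) :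
    gaps Δ b = {m | b < m ∧ m ∉ D}.ncard := by
  rw [gaps]
  congr 2
  ext m
  constructor
  · rintro ⟨h1, h2⟩
    have hlt : b < m := lt_of_le_of_ne h1 fun h => h2 (h ▸ hb)
    exact ⟨hlt, fun h' => h2 ((h m hlt).mpr h')⟩
  · rintro ⟨h1, h2⟩
    exact ⟨h1.le, fun h' => h2 ((h m h1).mp h')⟩

/-- The change of the number of coordinates when the largest module is enlarged. -/
theorem ncard_freeIndices_sub {P Q g : ℕ} {D E : Set ℕ} (hP : 0 < P) (hD : Dᶜ.Finite)
    (hDQ : ∀ n ∈ D, n + Q ∈ D) (hEP : ∀ n ∈ E, n + P ∈ E)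
    (hP' : ∀ n ∈ E ∪ {g}, n + P ∈ E ∪ {g}) (hQ' : ∀ n ∈ E ∪ {g}, n + Q ∈ E ∪ {g}) (hg : g ∉ E)
    (h : ∀ m, g < m → (m ∈ E ∪ {g} ↔ m ∈ D)) :
    ((freeIndices P Q D (E ∪ {g})).ncard : ℤ) - (freeIndices P Q D E).ncard =
      gaps (E ∪ {g}) g - gaps (E ∪ {g}) (g + P) -
        (gaps (E ∪ {g}) (g + Q) - gaps (E ∪ {g}) (g + P + Q)) := by
  have hgg : g ∈ E ∪ {g} := Or.inr rfl
  have hgE : g + P ∈ E := by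
    rcases hP' g hgg with h' | h'
    · exact h'
    · have := Set.mem_singleton_iff.mp h'
      omega
  have h1 := ncard_freeIndices_union (Q := Q) hP hD hEP hgE hg
  have h2 := ncard_free_add_ncard_gaps hD hDQ g
  have h3 := ncard_free_add_ncard_gaps hD hDQ (g + P)
  rw [gaps_eq_ncard hgg h, gaps_eq_ncard (hP' g hgg) fun m hm => h m (by omega),
    gaps_eq_ncard (hQ' g hgg) fun m hm => h m (by omega),
    gaps_eq_ncard (hQ' _ (hP' g hgg)) fun m hm => h m (by omega)]
  omega

theorem IsStandard.isStandardFlag {Δ : Set ℕ} (h : IsStandard p q r Δ) :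
    IsStandardFlag p q r ![Δ] Fin.elim0 :=
  ⟨fun i => by fin_cases i; exact h, fun i => i.elim0, fun i => i.elim0, fun i => i.elim0⟩

theorem IsStandard.isStandardFlag_pair {Δ : Set ℕ} {g : ℕ} (h : IsStandard p q r Δ) (hg : g ∉ Δ)
    (h' : IsModule p q r (Δ ∪ {g})) : IsStandardFlag p q r ![Δ, Δ ∪ {g}] fun _ => g := by
  refine ⟨fun i => ?_, fun i => ?_, fun i => ?_, Subsingleton.strictMono _⟩
  · fin_cases i
    · exact h
    · exact ⟨h', fun j hj => Or.inl (h.standard j hj)⟩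
  · fin_cases i
    exact hg
  · fin_cases i
    rfl

end Combinatorics

/-! ### Dimension formulas and the main theorem -/

section Dimension

variable {p q r : ℕ} (k : Type u) [Field k]

theorem IsStandardFlag.isAffineSpace {ℓ : ℕ} {Δ : Fin (ℓ + 1) → Set ℕ} {g : Fin ℓ → ℕ}
    (h : IsStandardFlag p q r Δ g) (hp : 0 < p) (hq : 0 < q) (hcop : Nat.Coprime p q)
    (hr : 0 < r) : IsAffineSpace (flagCell k p q r Δ)
      (freeIndices (r * p) (r * q) (Δ 0) (Δ (Fin.last ℓ))).ncard := by
  have := (finite_freeIndices (P := r * p) (Q := r * q) (E := Δ (Fin.last ℓ))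
    ((h.isStandard 0).finite_compl hcop hr)).to_subtype
  exact isAffineSpace_flagCell (h.admissible hp hq hcop hr) (Nat.mul_pos hr hq)
    (Finite.equivFin _).symm

theorem IsStandard.dimInt_cell {Δ : Set ℕ} (h : IsStandard p q r Δ) (hp : 0 < p) (hq : 0 < q)
    (hcop : Nat.Coprime p q) (hr : 0 < r) :
    dimInt (cell k p q r Δ) = (freeIndices (r * p) (r * q) Δ Δ).ncard :=
  (h.isStandardFlag.isAffineSpace k hp hq hcop hr).dimInt_eq

theorem IsStandard.dimChange_eq {Δ : Set ℕ} {g : ℕ} (h : IsStandard p q r Δ) (hg : g ∉ Δ)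
    (h' : IsModule p q r (Δ ∪ {g})) (hp : 0 < p) (hq : 0 < q) (hcop : Nat.Coprime p q)
    (hr : 0 < r) :
    dimChange k p q r Δ g = gaps (Δ ∪ {g}) g - gaps (Δ ∪ {g}) (g + r * p) -
      (gaps (Δ ∪ {g}) (g + r * q) - gaps (Δ ∪ {g}) (g + r * p + r * q)) := by
  rw [dimChange, h.dimInt_cell k hp hq hcop hr,
    ((h.isStandardFlag_pair hg h').isAffineSpace k hp hq hcop hr).dimInt_eq]
  refine ncard_freeIndices_sub (Nat.mul_pos hr hp) (h.finite_compl hcop hr)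
    (fun n => h.isModule.add_mem right_mem_semigroup)
    (fun n => h.isModule.add_mem left_mem_semigroup) (fun n => h'.add_mem left_mem_semigroup)
    (fun n => h'.add_mem right_mem_semigroup) hg fun m hm => ?_
  exact or_iff_left hm.ne'

/-- Both sides are given by the same gap formula for `Δ i.succ`: `ncard_freeIndices_sub` applies to
the base module `Δ 0` as well as to `Δ i.castSucc`, because both agree with `Δ i.succ` above `g i`.
-/
theorem IsStandardFlag.ncard_freeIndices_succ_sub {ℓ : ℕ} {Δ : Fin (ℓ + 1) → Set ℕ} {g : Fin ℓ → ℕ}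
    (h : IsStandardFlag p q r Δ g) (hp : 0 < p) (hq : 0 < q) (hcop : Nat.Coprime p q)
    (hr : 0 < r) (i : Fin ℓ) :
    ((freeIndices (r * p) (r * q) (Δ 0) (Δ i.succ)).ncard : ℤ) -
      (freeIndices (r * p) (r * q) (Δ 0) (Δ i.castSucc)).ncard =
      dimChange k p q r (Δ i.castSucc) (g i) := by
  have hi := (h.isStandard i.castSucc)
  have h' := (h.isStandard i.succ).isModule
  have h0 : ∀ m, g i < m → m ∈ Δ i.succ → m ∈ Δ 0 := fun m hm hm' => h.mem_zero hm' hm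
  rw [h.step] at h' h0 ⊢
  rw [hi.dimChange_eq k (h.notMem i) h' hp hq hcop hr]
  exact ncard_freeIndices_sub (Nat.mul_pos hr hp) ((h.isStandard 0).finite_compl hcop hr)
    (fun n => (h.isStandard 0).isModule.add_mem right_mem_semigroup)
    (fun n => hi.isModule.add_mem left_mem_semigroup) (fun n => h'.add_mem left_mem_semigroup)
    (fun n => h'.add_mem right_mem_semigroup) (h.notMem i)
    fun m hm => ⟨h0 m hm, fun hm' => Or.inl (h.monotone (Fin.zero_le _) hm')⟩

end Dimension

end TorusCell

theorem mainTheorem2 {k : Type u} [Field k] (p q r : ℕ) (hp : 0 < p) (hpq : p < q)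
    (hcop : Nat.Coprime p q) (hr : 0 < r) :
    (∀ (ℓ : ℕ) (Δ : Fin (ℓ + 1) → Set ℕ) (g : Fin ℓ → ℕ),
      TorusCell.IsStandardFlag p q r Δ g →
      ∃ N : ℕ, TorusCell.IsAffineSpace (TorusCell.flagCell k p q r Δ) N ∧
        (N : ℤ) = TorusCell.dimInt (TorusCell.cell k p q r (Δ 0)) +
          ∑ i : Fin ℓ, TorusCell.dimChange k p q r (Δ i.castSucc) (g i)) ∧
    (∀ (Δ : Set ℕ) (g : ℕ), TorusCell.IsStandard p q r Δ → g ∉ Δ →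
      TorusCell.IsModule p q r (Δ ∪ {g}) →
      TorusCell.dimChange k p q r Δ g =
        TorusCell.gaps (Δ ∪ {g}) g - TorusCell.gaps (Δ ∪ {g}) (g + r * p) -
          (TorusCell.gaps (Δ ∪ {g}) (g + r * q) -
            TorusCell.gaps (Δ ∪ {g}) (g + r * p + r * q))) := by
  have hq : 0 < q := hp.trans hpq
  refine ⟨fun ℓ Δ g h => ⟨_, h.isAffineSpace k hp hq hcop hr, ?_⟩,
    fun Δ g h hg h' => h.dimChange_eq k hg h' hp hq hcop hr⟩
  rw [(h.isStandard 0).dimInt_cell k hp hq hcop hr]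
  simp only [← h.ncard_freeIndices_succ_sub k hp hq hcop hr, Finset.sum_sub_distrib]
  -- The sum of the increments telescopes: the same total over `Fin (ℓ + 1)` is split off at its
  -- first and at its last term.
  have h1 := Fin.sum_univ_succ fun i : Fin (ℓ + 1) =>
    ((TorusCell.freeIndices (r * p) (r * q) (Δ 0) (Δ i)).ncard : ℤ)
  have h2 := Fin.sum_univ_castSucc fun i : Fin (ℓ + 1) =>
    ((TorusCell.freeIndices (r * p) (r * q) (Δ 0) (Δ i)).ncard : ℤ)
  linarith
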